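/- Let $0<|q|<1$, let $b_1,b_2,b_3,b_4,b_6,t$ be complex with $b_1b_2b_3b_4=1$, $b_6\neq0$, $t\ne 0$, and consider the deformed big $q$-Jacobi weight $$w(x;t)=\frac{(b_2x,\,b_3x,\,b_6^{-1}xt^{-1};q)_\infty}{(b_1x,\,b_4x,\,b_6xt^{-1};q)_\infty},$$ together with the polynomials $W,V$ given by $$W+\Delta y\,V=b_6(1-b_1x)(1-b_4x)(t-b_6x),\qquad W-\Delta y\,V=(1-b_2x)(1-b_3x)(b_6t-x),\qquad \Delta y=(q-1)x .$$ Assume that at the times $t$ and $qt$ the weight is regular: $W$ and $V$ are coprime, and two distinct zeros of $W^2-\Delta y^2V^2$ never differ by a factor $q^k$, $k\in\mathbb Z$. Integrate by the Thomae–Jackson $q$-integral between two zeros of the weight, i.e. between points $q^{-k}\zeta$ with $k\ge 0$, $\zeta\in\{b_2^{-1},b_3^{-1},b_6t\}$ (the same choices of $k$ and of $\zeta$ at both times), and suppose that at both times there is a system of orthonormal polynomials $p_m$ ($m\ge0$, $\deg p_m=m$, $\int w\,p_mp_k\,d_qx=\delta_{mk}$), with leading coefficient $\gamma_m$. Put $$q_m(x)=\int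 w(y;t)\frac{p_m(y)}{x-y}\,d_qy,\qquad a_m=\gamma_{m-1}/\gamma_m\ (m\ge1),\qquad a_0\neq0 \text{ arbitrary},\qquad p_{-1}=0,\quad q_{-1}=\frac1{a_0\gamma_0},$$ $$Y_n=\begin{pmatrix}p_n&q_n/w\\p_{n-1}&q_{n-1}/w\end{pmatrix},\qquad \mathbb D_xF(x)=\frac{F(qx)-F(x)}{qx-x},\qquad \mathbb M_xF(x)=\tfrac12\big(F(qx)+F(x)\big).$$ Fix $n\in\mathbb Z_{\ge0}$ and put $b_5=q^nb_1b_4b_6$, so that $q^n=b_5/(b_1b_4b_6)$. Assume $b_5\ne\pm1$, $qb_5^2\neq1$ and $b_5\ne q^{-1}$. Then, at each of the times $t$ and $qt$, there are unique polynomials $W_n\ne0,\Omega_n,\Theta_n,\Theta_{n-1}$ in $x$ such that $$\mathbb D_xY_n=\frac1{W_n}\begin{pmatrix}\Omega_n&-a_n\Theta_n\\a_n\Theta_{n-1}&-\Omega_n-2V\end{pmatrix}\mathbb M_xY_n,\qquad W_n(W_n-W)=-\tfrac14\Delta y^2\det\begin{pmatrix}\Omega_n&-a_n\Theta_n\\a_n\Theta_{n-1}&-\Omega_n-2V\end{pmatrix},$$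 the first equation being required for $x\ne0$ outside the $q$-lattices $\{q^k\tilde x:k\in\mathbb Z\}$ generated by the zeros $\tilde x$ of $W^2-\Delta y^2V^2$; and $\Theta_n$ has a unique zero. Let $g$ and $\hat g$ be the zeros of $\Theta_n$ at the times $t$ and $qt$, and assume $g\ne0,\,b_6t,\,b_6^{-1}t$ and $\hat g\neq 0,\,b_6qt,\,b_6^{-1}qt$. Define $f$ as follows, where $W_n,W,\Omega_n,V$ are taken at the time $\tau=qt$ and $\kappa_+=-b_5b_6$, $\kappa_-=-b_6/b_5$: determine $z_\pm$ from $$(2W_n-W)(\hat g)=\tfrac12\hat g\,(\kappa_+z_++\kappa_-z_-),\qquad (\Omega_n+V)(\hat g)=\frac{\kappa_+z_+-\kappa_-z_-}{2(q-1)},$$ then $Z$ from $$z_+=\frac{(\hat g-\tau b_6)(b_6\hat g-\tau)\,[(b_5\tau-Z)\hat g-1]}{b_5b_6\tau\,\hat g},$$ and put $f=b_5\tau-Z$. Assume $f\ne0$, $b_5f\ne t$, $f\neq b_5qt$ and $$\hat g\ne\frac{1-qb_5tg-qb_5^2+qb_5^2fg}{f-b_5qt}.$$ Then $$(f\hat g-1)(fg-1)=qt^2\,\frac{(f-b_1)(f-b_2)(f-b_3)(f-b_4)}{(f-b_5qt)(f-b_5^{-1}t)}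 .$$ -/

import Mathlib

open Polynomial

noncomputable section

namespace DeformedBigQJacobi

/-- The infinite `q`-shifted factorial `(a; q)_∞ = ∏_{k ≥ 0} (1 - a q ^ k)`. -/
def qShifted (q a : ℂ) : ℂ := ∏' k : ℕ, (1 - a * q ^ k)

/-- The Thomae-Jackson `q`-integral from `0` to `α`. -/
def jacksonZero (q α : ℂ) (φ : ℂ → ℂ) : ℂ :=
  (1 - q) * α * ∑' s : ℕ, q ^ s * φ (α * q ^ s)

/-- The Thomae-Jackson `q`-integral from `α` to `β`. -/
def jackson (q α β : ℂ) (φ : ℂ → ℂ) : ℂ := jacksonZero q β φ - jacksonZero q α φ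

/-- The divided-difference operator on the lattice `ι₊ x = q x`, `ι₋ x = x`, applied entrywise. -/
def dividedDiff (q : ℂ) (F : ℂ → Matrix (Fin 2) (Fin 2) ℂ) (x : ℂ) : Matrix (Fin 2) (Fin 2) ℂ :=
  (q * x - x)⁻¹ • (F (q * x) - F x)

/-- The mean operator on the lattice `ι₊ x = q x`, `ι₋ x = x`, applied entrywise. -/
def meanOp (q : ℂ) (F : ℂ → Matrix (Fin 2) (Fin 2) ℂ) (x : ℂ) : Matrix (Fin 2) (Fin 2) ℂ :=
  (1 / 2 : ℂ) • (F (q * x) + F x)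

/-- The base `q` and the parameters of the deformed big `q`-Jacobi weight. -/
structure Params where
  q : ℂ
  b1 : ℂ
  b2 : ℂ
  b3 : ℂ
  b4 : ℂ
  b6 : ℂ

namespace Params

variable (P : Params)

/-- The deformed big `q`-Jacobi weight `w(x; t)`. -/
def weight (t x : ℂ) : ℂ :=
  (qShifted P.q (P.b2 * x) * qShifted P.q (P.b3 * x) * qShifted P.q (P.b6⁻¹ * x * t⁻¹)) /
    (qShifted P.q (P.b1 * x) * qShifted P.q (P.b4 * x) * qShifted P.q (P.b6 * x * t⁻¹))

/-- The zeros of the weight: `q ^ (-k)` times one of `1 / b2`, `1 / b3`, `b6 t`. They serve as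
terminals of the `q`-integral. -/
def terminal (t : ℂ) (a : Fin 3 × ℕ) : ℂ :=
  (![P.b2⁻¹, P.b3⁻¹, P.b6 * t] a.1) * (P.q ^ a.2)⁻¹

/-- The `q`-integral of `w(x; t) φ(x)` between two zeros of the weight. -/
def integral (t : ℂ) (a b : Fin 3 × ℕ) (φ : ℂ → ℂ) : ℂ :=
  jackson P.q (P.terminal t a) (P.terminal t b) (fun x => P.weight t x * φ x)

/-- The orthonormal polynomial system of the weight at time `t`: `p n` has exact degree `n`. -/
def IsOPS (t : ℂ) (a b : Fin 3 × ℕ) (p : ℕ → ℂ[X]) : Prop :=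
  (∀ n : ℕ, (p n).degree = (n : WithBot ℕ)) ∧
    ∀ m n : ℕ, P.integral t a b (fun x => (p m).eval x * (p n).eval x) = if m = n then 1 else 0

/-- The associated function (function of the second kind) `q_n(x) = ∫ w(y) p_n(y) / (x - y)`. -/
def assoc (t : ℂ) (a b : Fin 3 × ℕ) (p : ℕ → ℂ[X]) (n : ℕ) (x : ℂ) : ℂ :=
  P.integral t a b (fun y => (p n).eval y / (x - y))

/-- The coefficient `a_n` of the three-term recurrence: the ratio `γ_{n-1} / γ_n` of leading
coefficients for `n ≥ 1`, and the free constant `a₀` for `n = 0`. -/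
def recA (a₀ : ℂ) (p : ℕ → ℂ[X]) : ℕ → ℂ
  | 0 => a₀
  | n + 1 => (p n).leadingCoeff / (p (n + 1)).leadingCoeff

/-- `p_{n-1}`, with `p_{-1} = 0`. -/
def prevPoly (p : ℕ → ℂ[X]) : ℕ → ℂ[X]
  | 0 => 0
  | n + 1 => p n

/-- `q_{n-1}`, with `q_{-1} = 1 / (a₀ γ₀)`. -/
def prevAssoc (t : ℂ) (a b : Fin 3 × ℕ) (a₀ : ℂ) (p : ℕ → ℂ[X]) : ℕ → ℂ → ℂ
  | 0 => fun _ => 1 / (a₀ * (p 0).leadingCoeff)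
  | n + 1 => P.assoc t a b p n

/-- The matrix variable `Y_n(x; t)`. -/
def Y (t : ℂ) (a b : Fin 3 × ℕ) (a₀ : ℂ) (p : ℕ → ℂ[X]) (n : ℕ) (x : ℂ) :
    Matrix (Fin 2) (Fin 2) ℂ :=
  !![(p n).eval x, P.assoc t a b p n x / P.weight t x;
     (prevPoly p n).eval x, P.prevAssoc t a b a₀ p n x / P.weight t x]

/-- The polynomial `W + Δy V`. -/
def Wplus (t : ℂ) : ℂ[X] :=
  C P.b6 * (1 - C P.b1 * X) * (1 - C P.b4 * X) * (C t - C P.b6 * X)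

/-- The polynomial `W - Δy V`. -/
def Wminus (t : ℂ) : ℂ[X] :=
  (1 - C P.b2 * X) * (1 - C P.b3 * X) * (C (P.b6 * t) - X)

/-- `Δy(x) = (q - 1) x`, as a polynomial. -/
def deltaY : ℂ[X] := C (P.q - 1) * X

/-- The spectral data polynomial `W`. -/
def W (t : ℂ) : ℂ[X] := C (1 / 2) * (P.Wplus t + P.Wminus t)

/-- The spectral data polynomial `V`; see `deltaY_mul_V`. -/
def V (t : ℂ) : ℂ[X] := C (1 / (2 * (P.q - 1))) * (P.Wplus t - P.Wminus t).divX

theorem deltaY_mul_V (hq : P.q ≠ 1) (t : ℂ) :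
    P.deltaY * P.V t = C (1 / 2) * (P.Wplus t - P.Wminus t) := by
  have h0 : (P.Wplus t - P.Wminus t).coeff 0 = 0 := by
    rw [coeff_zero_eq_eval_zero]
    simp [Wplus, Wminus]
  have hX := divX_mul_X_add (P.Wplus t - P.Wminus t)
  rw [h0, C_0, add_zero] at hX
  have hc : (C (P.q - 1) * C (1 / (2 * (P.q - 1))) : ℂ[X]) = C (1 / 2) := by
    rw [← C_mul]
    congr 1
    have : P.q - 1 ≠ 0 := sub_ne_zero.mpr hq
    field_simp
  conv_rhs => rw [← hX]
  rw [← hc, deltaY, V]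
  ring

/-- Regularity of the semi-classical weight at time `t`: the spectral data are coprime, and the
lattice generated by a zero of `W² - Δy² V²` contains no other zero. -/
def Regular (t : ℂ) : Prop :=
  IsCoprime (P.Wplus t) (P.Wminus t) ∧
    ∀ x y : ℂ, (P.Wplus t * P.Wminus t).IsRoot x → (P.Wplus t * P.Wminus t).IsRoot y → x ≠ y →
      ∀ k : ℤ, y ≠ P.q ^ k * x

/-- The points `x` that lie off every lattice generated by a zero of `W² - Δy² V²` and differ from
the fixed point `0`; there the weight is finite and nonzero and the associated functions are
defined. -/
def OffLattice (t x : ℂ) : Prop :=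
  x ≠ 0 ∧ ∀ k : ℤ, ¬ (P.Wplus t * P.Wminus t).IsRoot (P.q ^ k * x)

/-- The parameter `b₅ = q ^ n b₁ b₄ b₆`. -/
def b5 (n : ℕ) : ℂ := P.q ^ n * P.b1 * P.b4 * P.b6

end Params

/-- The polynomials `W_n`, `Ω_n`, `Θ_n` and `Θ_{n-1}`. -/
structure SpectralCoeffs where
  Wn : ℂ[X]
  Om : ℂ[X]
  Th : ℂ[X]
  ThPrev : ℂ[X]

namespace Params

variable (P : Params)

/-- `S` consists of the spectral coefficients at index `n` and time `t`: the matrix variable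
satisfies `D_x Y_n = A_n M_x Y_n` with
`A_n = W_n⁻¹ (Ω_n, -a_n Θ_n; a_n Θ_{n-1}, -Ω_n - 2 V)` (written without the denominator `W_n ≠ 0`),
and `W_n (W_n - W)` is `-Δy² / 4` times the determinant of the numerator of `A_n`; the last identity
only fixes the common scale of the four polynomials when `V = 0`. -/
def IsSpectral (t : ℂ) (a b : Fin 3 × ℕ) (a₀ : ℂ) (p : ℕ → ℂ[X]) (n : ℕ)
    (S : SpectralCoeffs) : Prop :=
  S.Wn ≠ 0 ∧
  (∀ x : ℂ, P.OffLattice t x →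
    S.Wn.eval x • dividedDiff P.q (P.Y t a b a₀ p n) x =
      !![S.Om.eval x, -(recA a₀ p n) * S.Th.eval x;
         recA a₀ p n * S.ThPrev.eval x, -S.Om.eval x - 2 * (P.V t).eval x] *
        meanOp P.q (P.Y t a b a₀ p n) x) ∧
  S.Wn * (S.Wn - P.W t) =
    -(C (1 / 4) * P.deltaY ^ 2 *
      (S.Om * (-S.Om - 2 * P.V t) + C (recA a₀ p n ^ 2) * S.Th * S.ThPrev))

/-- `f` is obtained from the spectral coefficients `S` at time `τ` and the zero `lam` of `Θ_n`.
With `ν = (2 W_n - W)(lam)`, `μ = (Ω_n + V)(lam)`, `κ₊ = -b₅ b₆`, `κ₋ = -b₆ / b₅`, one solves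
`ν = lam (κ₊ z₊ + κ₋ z₋) / 2`, `μ = (κ₊ z₊ - κ₋ z₋) / (2 (q - 1))` for `z₊`, `z₋`, then
`z₊ = (lam - b₆ τ) (b₆ lam - τ) ((b₅ τ - Z) lam - 1) / (b₅ b₆ τ lam)` for `Z`, and
`Z = b₅ τ - f`. Thus `f` is the value of the variable `f` at the time `τ / q`. -/
def IsFVariable (n : ℕ) (τ : ℂ) (S : SpectralCoeffs) (lam f : ℂ) : Prop :=
  ∃ κp κm zp zm Z : ℂ,
    κp = -(P.b5 n * P.b6) ∧ κm = -(P.b6 / P.b5 n) ∧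
    (2 * S.Wn - P.W τ).eval lam = 1 / 2 * lam * (κp * zp + κm * zm) ∧
    (S.Om + P.V τ).eval lam = 1 / (2 * (P.q - 1)) * (κp * zp - κm * zm) ∧
    zp = 1 / (P.b5 n * P.b6 * τ) *
      ((lam - τ * P.b6) * (P.b6 * lam - τ) * ((P.b5 n * τ - Z) * lam - 1) / lam) ∧
    Z = P.b5 n * τ - f

end Params

end DeformedBigQJacobi

end

/-!
The statement is a consequence of the compatibility of two linear shifts of the matrix variable
`Y_n`, one in space (`x ↦ q x`) and one in time (`t ↦ q t`), whose coefficient matrices are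
polynomial in `x` and of known, small degree.

*Space.* Let `F(x) = ∫ w(y; t) / (x - y) d_q y` be the Stieltjes transform of the weight. The
Pearson equation of `w` and the vanishing of `w` at the terminals give an inhomogeneous equation
`(W - Δy V)(x) F(q x) = (W + Δy V)(x) F(x) + U(x)` with a polynomial `U` that vanishes at `0`
(`exists_stieltjes_pearson`). Since the functions of the second kind are polynomial combinations of
`F` and `1`, one has `Y_n = M (1, F / w; 0, 1 / w)` with a polynomial matrix `M` of constant
determinant; these data form a `Gauge`. Hence `(W + Δy V) Y_n(q x) = K(x) Y_n(x)` with a polynomial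
matrix `K` (`Gauge.transfer`) such that `K(0) = b₆ t` and `det K = W² - Δy² V²`. Orthogonality, in
the form of the decay of the functions of the second kind, determines the degrees and the leading
coefficients of the entries of `K`.

*Spectral coefficients.* The equation for `D_x Y_n` is equivalent to the one with `K` by a Cayley
transform, and the polynomials `W_n, Ω_n, Θ_n, Θ_{n-1}` are the coordinates of `K`
(`Gauge.isSpectral_iff`). Existence and uniqueness follow. In particular `K₀₁ = -a_n Δy Θ_n` has
degree two, so `Θ_n` has a single zero, and `K₀₀` at the zero `ĝ` is `ĝ κ₊ z₊`; the definition of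
`f` amounts to `q t K₀₀(ĝ) = -(b₆ q t - ĝ) (q t - b₆ ĝ) (f ĝ - 1)`, with `K` at the time `q t`.

*Time.* The weights at `t` and `q t` differ by a rational factor, so that `F` evolves by
`exists_stieltjes_shift` and `(b₆ q t - x) Y_n(x; q t) = J(x) Y_n(x; t)` with a polynomial matrix
`J` (`Gauge.step`) that has linear diagonal entries and a constant entry `J₀₁ = j`. With
`β(x) = (b₆ t - x) (t - b₆ x)`, `β'` and `L` being `β` and `K` at the time `q t`, the two shifts are
compatible: `β' J(q x) K = q β L J` (`Gauge.step_compat`).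

*Elimination.* By regularity `β` and `β'` are coprime, so `β` divides the first row of `J(q x) K`.
The cofactor of the second entry is linear, and its values at `0` and at `ĝ` show that its zero is
`1 / f`. Comparing determinants there expresses `det K / β`, that is `b₆` times the product of the
factors `1 - b_i / f`, by the values at `1 / f` of `K₀₁` and `L₀₁`, which are `f g - 1` and
`f ĝ - 1` up to known factors; the remaining constants are removed by the leading coefficients of
the cofactor (`elimination`, `Gauge.zero_relation`).
-/

namespace DeformedBigQJacobi

open Filter Topology Bornology

/-! ### The infinite `q`-shifted factorial -/

section QShifted

variable {q : ℂ}

lemma summable_norm_qShifted (hq1 : ‖q‖ < 1) (a : ℂ) : Summable fun k : ℕ => ‖-(a * q ^ k)‖ := by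
  simp only [norm_neg, norm_mul, norm_pow]
  exact (summable_geometric_of_lt_one (norm_nonneg _) hq1).mul_left _

lemma qShifted_eq_tprod_one_add (q a : ℂ) : qShifted q a = ∏' k : ℕ, (1 + -(a * q ^ k)) := by
  simp only [qShifted, sub_eq_add_neg]

lemma multipliable_qShifted (hq1 : ‖q‖ < 1) (a : ℂ) :
    Multipliable fun k : ℕ => 1 + -(a * q ^ k) :=
  multipliable_one_add_of_summable (summable_norm_qShifted hq1 a)

lemma qShifted_eq_mul (hq1 : ‖q‖ < 1) (a : ℂ) :
    qShifted q a = (1 - a) * qShifted q (q * a) := by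
  have h : ∀ k : ℕ, 1 + -(a * q ^ (k + 1)) = 1 + -(q * a * q ^ k) := fun k => by ring
  have hm : Multipliable fun k : ℕ => 1 + -(a * q ^ (k + 1)) := by
    simp only [h]
    exact multipliable_qShifted hq1 _
  have := tprod_eq_zero_mul' (f := fun k : ℕ => 1 + -(a * q ^ k)) hm
  simp only [h, pow_zero, mul_one] at this
  rw [qShifted_eq_tprod_one_add, this, qShifted_eq_tprod_one_add, ← sub_eq_add_neg]

lemma qShifted_eq_zero {a : ℂ} {k : ℕ} (h : a * q ^ k = 1) : qShifted q a = 0 :=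
  tprod_of_exists_eq_zero ⟨k, by rw [h, sub_self]⟩

lemma qShifted_ne_zero (hq1 : ‖q‖ < 1) {a : ℂ} (h : ∀ k : ℕ, a * q ^ k ≠ 1) :
    qShifted q a ≠ 0 := by
  rw [qShifted_eq_tprod_one_add]
  refine tprod_one_add_ne_zero_of_summable (fun k hk => h k ?_) (summable_norm_qShifted hq1 a)
  linear_combination -hk

@[simp] lemma qShifted_zero (q : ℂ) : qShifted q 0 = 1 := by simp [qShifted]

lemma norm_qShifted_sub_one_le (hq1 : ‖q‖ < 1) (a : ℂ) :
    ‖qShifted q a - 1‖ ≤ Real.exp (‖a‖ * (1 - ‖q‖)⁻¹) - 1 := by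
  rw [qShifted_eq_tprod_one_add]
  refine le_of_tendsto ((multipliable_qShifted hq1 a).hasProd.sub_const 1).norm
    (Eventually.of_forall fun s => (s.norm_prod_one_add_sub_one_le _).trans ?_)
  gcongr
  refine ((summable_norm_qShifted hq1 a).sum_le_tsum s fun _ _ => norm_nonneg _).trans_eq ?_
  simp only [norm_neg, norm_mul, norm_pow]
  rw [tsum_mul_left, tsum_geometric_of_lt_one (norm_nonneg _) hq1]

lemma continuousAt_qShifted (hq1 : ‖q‖ < 1) : ContinuousAt (qShifted q) 0 := by
  rw [ContinuousAt, qShifted_zero, tendsto_iff_norm_sub_tendsto_zero]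
  refine squeeze_zero (fun _ => norm_nonneg _) (norm_qShifted_sub_one_le hq1) ?_
  have : ContinuousAt (fun a : ℂ => Real.exp (‖a‖ * (1 - ‖q‖)⁻¹) - 1) 0 := by fun_prop
  simpa [ContinuousAt] using this

lemma continuousAt_qShifted_mul (hq1 : ‖q‖ < 1) (c : ℂ) :
    ContinuousAt (fun x => qShifted q (c * x)) 0 := by
  refine ContinuousAt.comp' ?_ (by fun_prop)
  simpa using continuousAt_qShifted hq1

end QShifted

/-! ### The weight and its regularity -/

namespace Params

variable {P : Params} {t : ℂ}

lemma weight_eq (P : Params) (t x : ℂ) : P.weight t x =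
    (qShifted P.q (P.b2 * x) * qShifted P.q (P.b3 * x) * qShifted P.q (P.b6⁻¹ * t⁻¹ * x)) /
    (qShifted P.q (P.b1 * x) * qShifted P.q (P.b4 * x) * qShifted P.q (P.b6 * t⁻¹ * x)) := by
  rw [weight, mul_right_comm P.b6⁻¹, mul_right_comm P.b6]

lemma continuousAt_weight (hq1 : ‖P.q‖ < 1) (t : ℂ) : ContinuousAt (P.weight t) 0 := by
  rw [funext (weight_eq P t)]
  have h := continuousAt_qShifted_mul hq1
  exact ContinuousAt.div (((h _).fun_mul (h _)).fun_mul (h _)) (((h _).fun_mul (h _)).fun_mul (h _))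
    (by simp)

lemma eval_Wplus (P : Params) (t x : ℂ) : (P.Wplus t).eval x =
    P.b6 * (1 - P.b1 * x) * (1 - P.b4 * x) * (t - P.b6 * x) := by
  simp [Wplus]

lemma eval_Wminus (P : Params) (t x : ℂ) : (P.Wminus t).eval x =
    (1 - P.b2 * x) * (1 - P.b3 * x) * (P.b6 * t - x) := by
  simp [Wminus]

/-- The Pearson equation of the weight. -/
lemma pearson (hq1 : ‖P.q‖ < 1) (hb6 : P.b6 ≠ 0) (ht : t ≠ 0) {x : ℂ}
    (hx : (P.Wplus t).eval x ≠ 0) :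
    P.weight t (P.q * x) * (P.Wminus t).eval x = P.weight t x * (P.Wplus t).eval x := by
  have e : ∀ c, qShifted P.q (c * x) = (1 - c * x) * qShifted P.q (c * (P.q * x)) := fun c => by
    rw [qShifted_eq_mul hq1, mul_left_comm]
  rw [eval_Wplus] at hx
  simp only [ne_eq, mul_eq_zero, not_or] at hx
  obtain ⟨⟨⟨-, h1⟩, h4⟩, h6⟩ := hx
  have h6' : 1 - P.b6 * t⁻¹ * x ≠ 0 := by
    contrapose h6
    field_simp at h6
    linear_combination h6
  rw [weight_eq P t x, e P.b1, e P.b2, e P.b3, e P.b4, e (P.b6 * t⁻¹), e (P.b6⁻¹ * t⁻¹),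
    weight_eq, eval_Wplus, eval_Wminus]
  generalize qShifted P.q (P.b1 * (P.q * x)) = u1
  generalize qShifted P.q (P.b2 * (P.q * x)) = u2
  generalize qShifted P.q (P.b3 * (P.q * x)) = u3
  generalize qShifted P.q (P.b4 * (P.q * x)) = u4
  generalize qShifted P.q (P.b6 * t⁻¹ * (P.q * x)) = u5
  generalize qShifted P.q (P.b6⁻¹ * t⁻¹ * (P.q * x)) = u6
  have e5 : P.b6 * t - x = P.b6 * t * (1 - P.b6⁻¹ * t⁻¹ * x) := by field_simp
  have e6 : t - P.b6 * x = t * (1 - P.b6 * t⁻¹ * x) := by field_simp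
  rw [e5, e6, show (1 - P.b1 * x) * u1 * ((1 - P.b4 * x) * u4) * ((1 - P.b6 * t⁻¹ * x) * u5)
    = ((1 - P.b1 * x) * (1 - P.b4 * x) * (1 - P.b6 * t⁻¹ * x)) * (u1 * u4 * u5) by ring]
  -- The remaining denominator may vanish, in which case both sides are zero.
  generalize u1 * u4 * u5 = D
  generalize 1 - P.b6 * t⁻¹ * x = v at *
  generalize 1 - P.b1 * x = v1 at *
  generalize 1 - P.b4 * x = v4 at *
  rcases eq_or_ne D 0 with rfl | hD
  · simp
  · field_simp

/-- The weights at the times `t` and `q t` differ by a rational factor. -/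
lemma weight_shift (hq0 : P.q ≠ 0) (hq1 : ‖P.q‖ < 1) (hb6 : P.b6 ≠ 0) (ht : t ≠ 0) {x : ℂ}
    (hx : P.q * t - P.b6 * x ≠ 0) :
    P.weight (P.q * t) x * (P.b6 * (P.q * t - P.b6 * x)) =
      P.weight t x * (P.b6 * P.q * t - x) := by
  have e : ∀ c, qShifted P.q (c * (P.q * t)⁻¹ * x) =
      (1 - c * (P.q * t)⁻¹ * x) * qShifted P.q (c * t⁻¹ * x) := fun c => by
    rw [qShifted_eq_mul hq1]
    congr 2
    field_simp
  have h6' : 1 - P.b6 * (P.q * t)⁻¹ * x ≠ 0 := by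
    contrapose hx
    field_simp at hx
    linear_combination hx
  rw [weight_eq, weight_eq, e, e]
  have e5 : P.b6 * P.q * t - x = P.b6 * (P.q * t) * (1 - P.b6⁻¹ * (P.q * t)⁻¹ * x) := by
    field_simp
  have e6 : P.q * t - P.b6 * x = (P.q * t) * (1 - P.b6 * (P.q * t)⁻¹ * x) := by field_simp
  rw [e5, e6]
  generalize 1 - P.b6 * (P.q * t)⁻¹ * x = v at *
  generalize 1 - P.b6⁻¹ * (P.q * t)⁻¹ * x = v'
  rw [mul_left_comm _ v]
  generalize qShifted P.q (P.b1 * x) * qShifted P.q (P.b4 * x) * qShifted P.q (P.b6 * t⁻¹ * x) = D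
  rcases eq_or_ne D 0 with rfl | hD
  · simp
  · field_simp

/-- Regularity separates the zeros of `W + Δy V` from the lattices of the zeros of `W - Δy V`. -/
lemma Regular.ne (h : P.Regular t) {x y : ℂ} (hx : (P.Wplus t).eval x = 0)
    (hy : (P.Wminus t).eval y = 0) (k : ℤ) : y ≠ P.q ^ k * x := by
  refine h.2 x y ?_ ?_ ?_ k
  · simp [hx]
  · simp [hy]
  · rintro rfl
    obtain ⟨u, v, huv⟩ := h.1
    simpa [hx, hy] using congrArg (Polynomial.eval x) huv

lemma eval_Wplus_root (hb6 : P.b6 ≠ 0) (t : ℂ) : (P.Wplus t).eval (t / P.b6) = 0 := by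
  rw [eval_Wplus, mul_div_cancel₀ _ hb6, sub_self, mul_zero]

lemma eval_Wminus_root (P : Params) (t : ℂ) : (P.Wminus t).eval (P.b6 * t) = 0 := by
  rw [eval_Wminus, sub_self, mul_zero]

/-- The base points of the terminals are zeros of `W - Δy V`. -/
lemma terminal_base (hb : P.b1 * P.b2 * P.b3 * P.b4 = 1) (t : ℂ) (i : Fin 3) :
    (P.Wminus t).eval (![P.b2⁻¹, P.b3⁻¹, P.b6 * t] i) = 0 := by
  have h2 : P.b2 ≠ 0 := by rintro h; simp [h] at hb
  have h3 : P.b3 ≠ 0 := by rintro h; simp [h] at hb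
  fin_cases i <;> simp [eval_Wminus, h2, h3]

section Terminal

variable (hq0 : P.q ≠ 0) (hb : P.b1 * P.b2 * P.b3 * P.b4 = 1) (hb6 : P.b6 ≠ 0) (ht : t ≠ 0)
include hq0 hb

/-- No point of the lattice of a terminal is a zero of `W + Δy V`, so that the weight has no pole at
the nodes of the `q`-integral. -/
lemma eval_Wplus_terminal_ne_zero (hreg : P.Regular t) (a : Fin 3 × ℕ) (k : ℤ) :
    (P.Wplus t).eval (P.q ^ k * P.terminal t a) ≠ 0 := by
  intro h
  refine hreg.ne h (terminal_base hb t a.1) (a.2 - k) ?_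
  rw [terminal, ← mul_assoc, ← zpow_add₀ hq0, sub_add_cancel, zpow_natCast, mul_left_comm,
    mul_inv_cancel₀ (pow_ne_zero _ hq0), mul_one]

lemma terminal_shift_ne_zero (hreg : P.Regular t) (a : Fin 3 × ℕ) (k : ℤ) :
    P.q * t - P.b6 * (P.q ^ k * P.terminal t a) ≠ 0 := by
  intro h
  refine eval_Wplus_terminal_ne_zero hq0 hb hreg a (k - 1) ?_
  rw [eval_Wplus, zpow_sub_one₀ hq0]
  refine mul_eq_zero_of_right _ (mul_left_cancel₀ hq0 ?_)
  field_simp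
  linear_combination h

include hb6 ht in
lemma weight_terminal (a : Fin 3 × ℕ) : P.weight t (P.terminal t a) = 0 := by
  have h2 : P.b2 ≠ 0 := by rintro h; simp [h] at hb
  have h3 : P.b3 ≠ 0 := by rintro h; simp [h] at hb
  obtain ⟨i, k⟩ := a
  have hk : P.q ^ k ≠ 0 := pow_ne_zero _ hq0
  rw [weight_eq]
  refine div_eq_zero_iff.mpr (Or.inl ?_)
  simp only [mul_eq_zero]
  fin_cases i
  · refine Or.inl (Or.inl (qShifted_eq_zero (k := k) ?_))
    simp [terminal, h2, hk]
  · refine Or.inl (Or.inr (qShifted_eq_zero (k := k) ?_))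
    simp [terminal, h3, hk]
  · refine Or.inr (qShifted_eq_zero (k := k) ?_)
    simp only [terminal, Fin.reduceFinMk, Matrix.cons_val]
    field_simp

lemma OffLattice.ne_terminal {x : ℂ} (hx : P.OffLattice t x) (a : Fin 3 × ℕ) (s : ℕ) :
    x ≠ P.terminal t a * P.q ^ s := by
  rintro rfl
  refine hx.2 (a.2 - s) ?_
  have : P.q ^ ((a.2 : ℤ) - s) * (P.terminal t a * P.q ^ s) = ![P.b2⁻¹, P.b3⁻¹, P.b6 * t] a.1 := by
    have h1 := pow_ne_zero s hq0
    have h2 := pow_ne_zero a.2 hq0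
    rw [zpow_sub₀ hq0, zpow_natCast, zpow_natCast, terminal]
    field_simp
  rw [this, IsRoot, eval_mul, terminal_base hb, mul_zero]

end Terminal

lemma OffLattice.zpow_mul (hq0 : P.q ≠ 0) {x : ℂ} (hx : P.OffLattice t x) (m : ℤ) :
    P.OffLattice t (P.q ^ m * x) := by
  refine ⟨mul_ne_zero (zpow_ne_zero _ hq0) hx.1, fun k => ?_⟩
  rw [← mul_assoc, ← zpow_add₀ hq0]
  exact hx.2 _

lemma OffLattice.eval_Wplus_ne_zero {x : ℂ} (hx : P.OffLattice t x) : (P.Wplus t).eval x ≠ 0 := by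
  intro h
  exact hx.2 0 (by simp [h])

lemma OffLattice.weight_ne_zero (hq1 : ‖P.q‖ < 1) (hb6 : P.b6 ≠ 0) (ht : t ≠ 0) {x : ℂ}
    (hx : P.OffLattice t x) : P.weight t x ≠ 0 := by
  have key : ∀ k : ℕ, (P.Wplus t).eval (P.q ^ k * x) ≠ 0 ∧ (P.Wminus t).eval (P.q ^ k * x) ≠ 0 := by
    intro k
    have := hx.2 k
    rwa [zpow_natCast, IsRoot, eval_mul, mul_eq_zero, not_or] at this
  simp only [eval_Wplus, eval_Wminus, ne_eq, mul_eq_zero, not_or] at key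
  have hz : ∀ c : ℂ, (∀ k : ℕ, 1 - c * (P.q ^ k * x) ≠ 0) → qShifted P.q (c * x) ≠ 0 := by
    intro c hc
    refine qShifted_ne_zero hq1 fun k hk => hc k ?_
    linear_combination -hk
  rw [weight_eq]
  refine div_ne_zero (mul_ne_zero (mul_ne_zero ?_ ?_) ?_) (mul_ne_zero (mul_ne_zero ?_ ?_) ?_)
  all_goals refine hz _ fun k => ?_
  · exact (key k).2.1.1
  · exact (key k).2.1.2
  · refine fun h => (key k).2.2 ?_
    field_simp at h
    linear_combination h
  · exact (key k).1.1.1.2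
  · exact (key k).1.1.2
  · refine fun h => (key k).1.2 ?_
    field_simp at h
    linear_combination h

/-- The zeros of `W² - Δy² V²` generate the same lattices at the times `t` and `q t`. -/
lemma OffLattice.shift (hq0 : P.q ≠ 0) {x : ℂ} (hx : P.OffLattice t x) :
    P.OffLattice (P.q * t) x := by
  refine ⟨hx.1, fun k => ?_⟩
  have h0 := hx.2 k
  have h1 := hx.2 (k - 1)
  simp only [IsRoot, eval_mul, eval_Wplus, eval_Wminus, mul_eq_zero, not_or,
    zpow_sub_one₀ hq0] at h0 h1 ⊢
  refine ⟨⟨⟨⟨h0.1.1.1.1, h0.1.1.1.2⟩, h0.1.1.2⟩, fun h => h1.1.2 (mul_left_cancel₀ hq0 ?_)⟩,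
    ⟨⟨h0.2.1.1, h0.2.1.2⟩, fun h => h1.2.2 (mul_left_cancel₀ hq0 ?_)⟩⟩
  · field_simp
    linear_combination h
  · field_simp
    linear_combination h

/-- The filter of points off the lattices that tend to infinity. -/
noncomputable def offLatticeAtInfinity (P : Params) (t : ℂ) : Filter ℂ :=
  cobounded ℂ ⊓ 𝓟 {x | P.OffLattice t x}

lemma exists_offLattice (hq0 : P.q ≠ 0) (hb6 : P.b6 ≠ 0) (ht : t ≠ 0) :
    ∃ x, P.OffLattice t x := by
  have hne : P.Wplus t * P.Wminus t ≠ 0 := by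
    intro h
    have := congrArg (Polynomial.eval 0) h
    simp [eval_Wplus, eval_Wminus, hb6, ht] at this
  have hc : ({0} ∪ ⋃ k : ℤ, ⋃ z ∈ (P.Wplus t * P.Wminus t).rootSet ℂ,
      {(P.q ^ k)⁻¹ * z} : Set ℂ).Countable :=
    (Set.countable_singleton 0).union (Set.countable_iUnion fun k =>
      ((rootSet_finite _ ℂ).countable.biUnion fun z _ => Set.countable_singleton _))
  obtain ⟨x, hx⟩ := (hc.dense_compl ℝ).nonempty
  simp only [Set.mem_compl_iff, Set.mem_union, Set.mem_singleton_iff, Set.mem_iUnion,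
    not_or, not_exists] at hx
  refine ⟨x, hx.1, fun k hk => hx.2 k (P.q ^ k * x) ?_ ?_⟩
  · rw [mem_rootSet]
    exact ⟨hne, by simpa [aeval_def] using hk⟩
  · rw [inv_mul_cancel_left₀ (zpow_ne_zero _ hq0)]

lemma offLatticeAtInfinity_neBot (hq0 : P.q ≠ 0) (hq1 : ‖P.q‖ < 1) (hb6 : P.b6 ≠ 0)
    (ht : t ≠ 0) : (P.offLatticeAtInfinity t).NeBot := by
  obtain ⟨x, hx⟩ := exists_offLattice hq0 hb6 ht
  have h : Tendsto (fun k : ℕ => P.q ^ (-k : ℤ) * x) atTop (P.offLatticeAtInfinity t) := by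
    refine tendsto_inf.mpr ⟨?_, tendsto_principal.mpr (.of_forall fun k => hx.zpow_mul hq0 _)⟩
    rw [← tendsto_norm_atTop_iff_cobounded]
    have : (fun k : ℕ => ‖P.q ^ (-k : ℤ) * x‖) = fun k => (‖P.q‖⁻¹) ^ k * ‖x‖ := by
      ext k
      simp
    rw [this]
    refine Tendsto.atTop_mul_const (norm_pos_iff.mpr hx.1) (tendsto_pow_atTop_atTop_of_one_lt ?_)
    exact (one_lt_inv₀ (norm_pos_iff.mpr hq0)).mpr hq1
  exact h.neBot

lemma eventually_offLattice (P : Params) (t : ℂ) :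
    ∀ᶠ x in P.offLatticeAtInfinity t, P.OffLattice t x :=
  mem_inf_of_right (mem_principal_self _)

lemma offLatticeAtInfinity_le (P : Params) (t : ℂ) : P.offLatticeAtInfinity t ≤ cobounded ℂ :=
  inf_le_left

lemma tendsto_mul_offLatticeAtInfinity (hq0 : P.q ≠ 0) (t : ℂ) :
    Tendsto (fun x => P.q * x) (P.offLatticeAtInfinity t) (P.offLatticeAtInfinity t) := by
  refine tendsto_inf.mpr ⟨?_, tendsto_principal.mpr ?_⟩
  · exact Tendsto.mono_left (map_mul_left_cobounded hq0).le inf_le_left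
  · filter_upwards [eventually_offLattice P t] with x hx
    simpa using hx.zpow_mul hq0 1

lemma offLatticeAtInfinity_le_shift (hq0 : P.q ≠ 0) (t : ℂ) :
    P.offLatticeAtInfinity t ≤ P.offLatticeAtInfinity (P.q * t) :=
  inf_le_inf_left _ (principal_mono.mpr fun _ hx => OffLattice.shift hq0 hx)

end Params

/-! ### Calculus of the `q`-integral -/

section Jackson

variable {q α β : ℂ}

lemma tendsto_node (hq1 : ‖q‖ < 1) (α : ℂ) : Tendsto (fun s : ℕ => α * q ^ s) atTop (𝓝 0) := by
  simpa using (tendsto_pow_atTop_nhds_zero_of_norm_lt_one hq1).const_mul α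

lemma norm_node_le (hq1 : ‖q‖ < 1) (α : ℂ) (s : ℕ) : ‖α * q ^ s‖ ≤ ‖α‖ := by
  rw [norm_mul, norm_pow]
  exact mul_le_of_le_one_right (norm_nonneg _) (pow_le_one₀ (norm_nonneg _) hq1.le)

lemma exists_norm_node_le (hq1 : ‖q‖ < 1) {h : ℂ → ℂ} (hh : ContinuousAt h 0) (α : ℂ) :
    ∃ C : ℝ, ∀ s : ℕ, ‖h (α * q ^ s)‖ ≤ C := by
  obtain ⟨C, hC⟩ := (hh.tendsto.comp (tendsto_node hq1 α)).norm.bddAbove_range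
  exact ⟨C, fun s => hC ⟨s, rfl⟩⟩

/-- The terms of the `q`-integral of a function that is continuous at `0` are summable. -/
lemma summable_jackson (hq1 : ‖q‖ < 1) {h : ℂ → ℂ} (hh : ContinuousAt h 0) (α : ℂ) :
    Summable fun s : ℕ => q ^ s * h (α * q ^ s) := by
  obtain ⟨C, hC⟩ := exists_norm_node_le hq1 hh α
  refine Summable.of_norm_bounded
    ((summable_geometric_of_lt_one (norm_nonneg _) hq1).mul_right C) fun s => ?_
  rw [norm_mul, norm_pow]
  gcongr
  exact hC s

lemma jacksonZero_congr {g h : ℂ → ℂ} (e : ∀ s : ℕ, g (α * q ^ s) = h (α * q ^ s)) :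
    jacksonZero q α g = jacksonZero q α h := by
  simp only [jacksonZero, e]

lemma jackson_congr {g h : ℂ → ℂ} (eα : ∀ s : ℕ, g (α * q ^ s) = h (α * q ^ s))
    (eβ : ∀ s : ℕ, g (β * q ^ s) = h (β * q ^ s)) : jackson q α β g = jackson q α β h := by
  rw [jackson, jackson, jacksonZero_congr eα, jacksonZero_congr eβ]

lemma jackson_add (hq1 : ‖q‖ < 1) {g h : ℂ → ℂ} (hg : ContinuousAt g 0) (hh : ContinuousAt h 0) :
    jackson q α β (fun y => g y + h y) = jackson q α β g + jackson q α β h := by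
  simp only [jackson, jacksonZero, mul_add]
  rw [(summable_jackson hq1 hg β).tsum_add (summable_jackson hq1 hh β),
    (summable_jackson hq1 hg α).tsum_add (summable_jackson hq1 hh α)]
  ring

lemma jackson_const_mul (c : ℂ) (h : ℂ → ℂ) :
    jackson q α β (fun y => c * h y) = c * jackson q α β h := by
  simp only [jackson, jacksonZero, mul_left_comm _ c, tsum_mul_left]
  ring

lemma jackson_sub (hq1 : ‖q‖ < 1) {g h : ℂ → ℂ} (hg : ContinuousAt g 0) (hh : ContinuousAt h 0) :
    jackson q α β (fun y => g y - h y) = jackson q α β g - jackson q α β h := by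
  have := jackson_add (α := α) (β := β) hq1 hg (hh.const_mul (-1))
  rw [jackson_const_mul] at this
  simpa [sub_eq_add_neg] using this

/-- The substitution `y ↦ q y`, when the integrand vanishes at the terminal. -/
lemma jacksonZero_shift (hq1 : ‖q‖ < 1) {h : ℂ → ℂ} (hh : ContinuousAt h 0) (hα : h α = 0) :
    jacksonZero q α (fun y => q * h (q * y)) = jacksonZero q α h := by
  rw [jacksonZero, jacksonZero, (summable_jackson hq1 hh α).tsum_eq_zero_add]
  congr 1
  simp only [pow_zero, mul_one, hα, mul_zero, zero_add]
  refine tsum_congr fun s => ?_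
  rw [show q * (α * q ^ s) = α * q ^ (s + 1) by ring]
  ring

lemma jackson_shift (hq1 : ‖q‖ < 1) {h : ℂ → ℂ} (hh : ContinuousAt h 0) (hα : h α = 0)
    (hβ : h β = 0) : jackson q α β (fun y => q * h (q * y)) = jackson q α β h := by
  rw [jackson, jackson, jacksonZero_shift hq1 hh hα, jacksonZero_shift hq1 hh hβ]

/-- A terminal at which the integrand vanishes may be multiplied by `q`. -/
lemma jacksonZero_mul_terminal (hq1 : ‖q‖ < 1) {h : ℂ → ℂ} (hh : ContinuousAt h 0)
    (hα : h α = 0) : jacksonZero q (q * α) h = jacksonZero q α h := by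
  rw [← jacksonZero_shift hq1 hh hα, jacksonZero, jacksonZero]
  simp only [mul_left_comm _ q, tsum_mul_left, mul_assoc q α]
  ring

/-- The fundamental theorem of calculus for the `q`-integral. -/
lemma jacksonZero_telescope (hq1 : ‖q‖ < 1) {g h : ℂ → ℂ} (hg : ContinuousAt g 0)
    (hh : ContinuousAt h 0)
    (e : ∀ s : ℕ, α * q ^ s * g (α * q ^ s) = h (q * (α * q ^ s)) - h (α * q ^ s)) :
    jacksonZero q α g = (1 - q) * (h 0 - h α) := by
  rw [jacksonZero, mul_assoc, ← tsum_mul_left]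
  congr 1
  have hs := (summable_jackson hq1 hg α).mul_left α
  refine tendsto_nhds_unique hs.hasSum.tendsto_sum_nat ?_
  have e' : ∀ s : ℕ, α * (q ^ s * g (α * q ^ s)) = h (α * q ^ (s + 1)) - h (α * q ^ s) := by
    intro s
    rw [← mul_assoc, e, show q * (α * q ^ s) = α * q ^ (s + 1) by ring]
  simp only [e', Finset.sum_range_sub (fun s => h (α * q ^ s)), pow_zero, mul_one]
  exact (hh.tendsto.comp (tendsto_node hq1 α)).sub_const _

lemma tendsto_jacksonZero_resolvent (hq1 : ‖q‖ < 1) {h : ℂ → ℂ} (hh : ContinuousAt h 0) (α : ℂ) :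
    Tendsto (fun x => jacksonZero q α fun y => h y / (x - y)) (cobounded ℂ) (𝓝 0) := by
  obtain ⟨C, hC⟩ := exists_norm_node_le hq1 hh α
  have key : Tendsto (fun x => ∑' s : ℕ, q ^ s * (h (α * q ^ s) / (x - α * q ^ s)))
      (cobounded ℂ) (𝓝 (∑' _ : ℕ, 0)) := by
    refine tendsto_tsum_of_dominated_convergence
      ((summable_geometric_of_lt_one (norm_nonneg q) hq1).mul_right C) (fun s => ?_) ?_
    · have : Tendsto (fun x : ℂ => x - α * q ^ s) (cobounded ℂ) (cobounded ℂ) :=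
        tendsto_sub_const_cobounded (α * q ^ s)
      simpa [div_eq_mul_inv] using
        (((tendsto_inv₀_cobounded (α := ℂ)).comp this).const_mul (h (α * q ^ s))).const_mul (q ^ s)
    · have : ∀ᶠ x : ℂ in cobounded ℂ, ‖α‖ + 1 ≤ ‖x‖ :=
        tendsto_norm_cobounded_atTop.eventually_ge_atTop _
      filter_upwards [this] with x hx s
      rw [norm_mul, norm_pow, norm_div]
      gcongr
      have h1 : 1 ≤ ‖x - α * q ^ s‖ := by
        have := norm_sub_norm_le x (α * q ^ s)
        have := norm_node_le hq1 α s
        linarith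
      exact (div_le_self (norm_nonneg _) h1).trans (hC s)
  simpa [jacksonZero] using key.const_mul ((1 - q) * α)

/-- The Stieltjes transform of a `q`-integral vanishes at infinity. -/
lemma tendsto_jackson_resolvent (hq1 : ‖q‖ < 1) {h : ℂ → ℂ} (hh : ContinuousAt h 0) (α β : ℂ) :
    Tendsto (fun x => jackson q α β fun y => h y / (x - y)) (cobounded ℂ) (𝓝 0) := by
  simpa [jackson] using
    (tendsto_jacksonZero_resolvent hq1 hh β).sub (tendsto_jacksonZero_resolvent hq1 hh α)

lemma continuousAt_resolvent {h : ℂ → ℂ} (hh : ContinuousAt h 0) {x : ℂ} (hx : x ≠ 0) :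
    ContinuousAt (fun y => h y / (x - y)) 0 :=
  hh.div (by fun_prop) (by simpa using hx)

variable {ω : ℂ → ℂ}

/-- `x` is distinct from `0` and from the nodes of the `q`-integral from `α` to `β`. -/
def OffNodes (q α β x : ℂ) : Prop := x ≠ 0 ∧ (∀ s : ℕ, x ≠ α * q ^ s) ∧ ∀ s : ℕ, x ≠ β * q ^ s

/-- A linear factor in the Stieltjes transform may be evaluated at `x`, up to a constant. -/
lemma jackson_linear_resolvent (hq1 : ‖q‖ < 1) {h : ℂ → ℂ} (hh : ContinuousAt h 0) {x : ℂ}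
    (hx : OffNodes q α β x) (u v : ℂ) :
    jackson q α β (fun y => h y * (u + v * y) / (x - y)) =
      (u + v * x) * jackson q α β (fun y => h y / (x - y)) - v * jackson q α β h := by
  rw [← jackson_const_mul, ← jackson_const_mul,
    ← jackson_sub hq1 ((continuousAt_resolvent hh hx.1).const_mul _) (hh.const_mul v)]
  have key : ∀ y, x ≠ y →
      h y * (u + v * y) / (x - y) = (u + v * x) * (h y / (x - y)) - v * h y := by
    intro y hy
    have := sub_ne_zero.mpr hy
    field_simp
    ring
  exact jackson_congr (fun s => key _ (hx.2.1 s)) (fun s => key _ (hx.2.2 s))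

lemma jackson_mul_resolvent (hq1 : ‖q‖ < 1) {h : ℂ → ℂ} (hh : ContinuousAt h 0) {x : ℂ}
    (hx : OffNodes q α β x) :
    jackson q α β (fun y => h y * y / (x - y)) =
      x * jackson q α β (fun y => h y / (x - y)) - jackson q α β h := by
  simpa using jackson_linear_resolvent hq1 hh hx 0 1

lemma continuousAt_mul_eval (hω : ContinuousAt ω 0) (g : ℂ[X]) :
    ContinuousAt (fun y => ω y * g.eval y) 0 :=
  hω.mul g.continuous.continuousAt

/-- Up to a polynomial, the Stieltjes transform of `g ω` is `g` times that of `ω`. -/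
lemma exists_secondKind (hq1 : ‖q‖ < 1) (hω : ContinuousAt ω 0) (α β : ℂ) (g : ℂ[X]) :
    ∃ r : ℂ[X], r.eval 0 = jackson q α β (fun y => ω y * g.divX.eval y) ∧
      ∀ x, OffNodes q α β x → jackson q α β (fun y => ω y * g.eval y / (x - y)) =
        g.eval x * jackson q α β (fun y => ω y / (x - y)) - r.eval x := by
  induction g using Polynomial.induction_on with
  | C c =>
    refine ⟨0, by simp [jackson, jacksonZero], fun x _ => ?_⟩
    simp only [eval_C, eval_zero, sub_zero, ← jackson_const_mul]
    congr 1
    ext y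
    ring
  | add g₁ g₂ h₁ h₂ =>
    obtain ⟨r₁, h0₁, h₁⟩ := h₁
    obtain ⟨r₂, h0₂, h₂⟩ := h₂
    refine ⟨r₁ + r₂, ?_, fun x hx => ?_⟩
    · simp only [divX_add, eval_add, mul_add, h0₁, h0₂]
      rw [jackson_add hq1 (continuousAt_mul_eval hω _) (continuousAt_mul_eval hω _)]
    · simp only [eval_add, mul_add, add_div]
      rw [jackson_add hq1 (continuousAt_resolvent (continuousAt_mul_eval hω _) hx.1)
        (continuousAt_resolvent (continuousAt_mul_eval hω _) hx.1), h₁ x hx, h₂ x hx]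
      ring
  | monomial n c h =>
    obtain ⟨r, -, h⟩ := h
    have e : (C c * X ^ (n + 1) : ℂ[X]) = X * (C c * X ^ n) := by ring
    refine ⟨X * r + C (jackson q α β (fun y => ω y * (C c * X ^ n : ℂ[X]).eval y)), ?_,
      fun x hx => ?_⟩
    · simp only [divX_C_mul_X_pow, Nat.add_eq_zero_iff, one_ne_zero, and_false, if_false,
        Nat.add_sub_cancel]
      simp
    · have := jackson_mul_resolvent hq1 (continuousAt_mul_eval hω (C c * X ^ n)) hx
      rw [h x hx] at this
      have e' : ∀ y, ω y * (X * (C c * X ^ n) : ℂ[X]).eval y / (x - y) =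
          ω y * (C c * X ^ n : ℂ[X]).eval y * y / (x - y) := fun y => by
        rw [eval_mul, eval_X]
        ring
      simp only [e, e', this]
      rw [eval_mul (p := X), eval_X, eval_add, eval_mul (p := X), eval_X, eval_C]
      ring

end Jackson

/-! ### Polynomials along a filter tending to infinity -/

section Degree

variable {l : Filter ℂ}

lemma tendsto_eval_div_pow (hl : l ≤ cobounded ℂ) {Q : ℂ[X]} {d : ℕ} (hd : Q.natDegree ≤ d) :
    Tendsto (fun x => Q.eval x / x ^ d) l (𝓝 (Q.coeff d)) := by
  have h0 : (Q.reflect d).eval 0 = Q.coeff d := by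
    rw [← coeff_zero_eq_eval_zero, coeff_reflect, revAt_le (Nat.zero_le d), Nat.sub_zero]
  have h1 : Tendsto (fun x : ℂ => (Q.reflect d).eval x⁻¹) l (𝓝 (Q.coeff d)) := by
    rw [← h0]
    exact ((Q.reflect d).continuous.tendsto 0).comp (tendsto_inv₀_cobounded.mono_left hl)
  refine h1.congr' ?_
  filter_upwards [hl (eventually_ne_cobounded 0)] with x hx
  let _ := invertibleOfNonzero hx
  have := eval₂_reflect_mul_pow (RingHom.id ℂ) x d Q hd
  rw [eval₂_id, eval₂_id, invOf_eq_inv] at this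
  rw [← this, mul_div_cancel_right₀ _ (pow_ne_zero _ hx)]

/-- A polynomial which is asymptotic to `c x ^ d` has degree at most `d` and coefficient `c` in
degree `d`. -/
lemma natDegree_le_of_tendsto [l.NeBot] (hl : l ≤ cobounded ℂ) {Q : ℂ[X]} {d : ℕ} {c : ℂ}
    (h : Tendsto (fun x => Q.eval x / x ^ d) l (𝓝 c)) : Q.natDegree ≤ d ∧ Q.coeff d = c := by
  have hd : Q.natDegree ≤ d := by
    by_contra! hd
    have h1 := tendsto_eval_div_pow hl (le_refl Q.natDegree)
    have h2 : Tendsto (fun x => Q.eval x / x ^ d * x⁻¹ ^ (Q.natDegree - d)) l (𝓝 0) := by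
      have := h.mul (((tendsto_inv₀_cobounded (α := ℂ)).mono_left hl).pow (Q.natDegree - d))
      rwa [zero_pow (by omega), mul_zero] at this
    have h3 : (fun x => Q.eval x / x ^ d * x⁻¹ ^ (Q.natDegree - d)) =
        fun x => Q.eval x / x ^ Q.natDegree := by
      ext x
      conv_rhs => rw [← Nat.add_sub_cancel' hd.le, pow_add]
      rw [inv_pow, ← div_eq_mul_inv, div_div]
    rw [h3] at h2
    have : Q.leadingCoeff = 0 := tendsto_nhds_unique h1 h2
    rw [leadingCoeff_eq_zero] at this
    simp [this] at hd
  exact ⟨hd, tendsto_nhds_unique (tendsto_eval_div_pow hl hd) h⟩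

/-- Polynomials that agree along a filter tending to infinity are equal. -/
lemma eq_of_eventually_eval_eq [l.NeBot] (hl : l ≤ cobounded ℂ) {Q R : ℂ[X]}
    (h : ∀ᶠ x in l, Q.eval x = R.eval x) : Q = R := by
  have h0 : Tendsto (fun x => (Q - R).eval x / x ^ 0) l (𝓝 0) := by
    refine tendsto_const_nhds.congr' ?_
    filter_upwards [h] with x hx
    simp [hx]
  obtain ⟨h1, h2⟩ := natDegree_le_of_tendsto hl h0
  rw [← sub_eq_zero, eq_C_of_natDegree_le_zero h1, h2, C_0]

end Degree

/-! ### The Stieltjes transform of the weight -/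

namespace Params

variable {P : Params} {t : ℂ}

/-- The Stieltjes transform `∫ w(y; t) / (x - y) d_q y` of the weight. -/
noncomputable def stieltjes (P : Params) (t : ℂ) (a b : Fin 3 × ℕ) (x : ℂ) : ℂ :=
  jackson P.q (P.terminal t a) (P.terminal t b) fun y => P.weight t y / (x - y)

section

variable (hq0 : P.q ≠ 0) (hq1 : ‖P.q‖ < 1) (hb : P.b1 * P.b2 * P.b3 * P.b4 = 1)

include hq0 hb in
lemma OffLattice.offNodes {x : ℂ} (hx : P.OffLattice t x) (a b : Fin 3 × ℕ) :
    OffNodes P.q (P.terminal t a) (P.terminal t b) x :=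
  ⟨hx.1, hx.ne_terminal hq0 hb a, hx.ne_terminal hq0 hb b⟩

variable (hb6 : P.b6 ≠ 0) (ht : t ≠ 0) (hreg : P.Regular t)
include hq0 hq1 hb hb6 ht hreg

lemma pearson_terminal (a : Fin 3 × ℕ) (s : ℕ) :
    P.weight t (P.q * (P.terminal t a * P.q ^ s)) * (P.Wminus t).eval (P.terminal t a * P.q ^ s) =
      P.weight t (P.terminal t a * P.q ^ s) * (P.Wplus t).eval (P.terminal t a * P.q ^ s) := by
  refine pearson hq1 hb6 ht ?_
  have := eval_Wplus_terminal_ne_zero hq0 hb hreg a s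
  rwa [zpow_natCast, mul_comm] at this

/-- The Stieltjes transform solves the inhomogeneous form of the Pearson equation. The
inhomogeneity vanishes at `0` because the weight takes the same value at all terminals, and so the
`q`-integral of its divided difference is zero. -/
lemma exists_stieltjes_pearson (a b : Fin 3 × ℕ) : ∃ U : ℂ[X], U.eval 0 = 0 ∧
    ∀ x, P.OffLattice t x → (P.Wminus t).eval x * P.stieltjes t a b (P.q * x) =
      (P.Wplus t).eval x * P.stieltjes t a b x + U.eval x := by
  have hw := continuousAt_weight (P := P) hq1 t
  have hw' : ContinuousAt (fun y => P.weight t (P.q * y)) 0 :=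
    ContinuousAt.comp' (by simpa using hw) (by fun_prop)
  obtain ⟨r₁, h0₁, h₁⟩ := exists_secondKind hq1 hw' (P.terminal t a) (P.terminal t b) (P.Wminus t)
  obtain ⟨r₂, h0₂, h₂⟩ := exists_secondKind hq1 hw (P.terminal t a) (P.terminal t b) (P.Wplus t)
  refine ⟨r₁ - r₂, ?_, fun x hx => ?_⟩
  · have hd := fun Q : ℂ[X] => fun x : ℂ => congrArg (Polynomial.eval x) (divX_mul_X_add Q)
    simp only [eval_add, eval_mul, eval_X, eval_C, coeff_zero_eq_eval_zero] at hd
    have key : ∀ c : Fin 3 × ℕ, jacksonZero P.q (P.terminal t c) (fun y =>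
        P.weight t (P.q * y) * (P.Wminus t).divX.eval y - P.weight t y * (P.Wplus t).divX.eval y) =
        (1 - P.q) * (-(P.b6 * t) * P.weight t 0 - -(P.b6 * t) * P.weight t (P.terminal t c)) := by
      intro c
      refine jacksonZero_telescope hq1 ((continuousAt_mul_eval hw' _).sub
        (continuousAt_mul_eval hw _)) (hw.const_mul (-(P.b6 * t))) fun s => ?_
      have hp := pearson_terminal hq0 hq1 hb hb6 ht hreg c s
      have hm := hd (P.Wminus t) (P.terminal t c * P.q ^ s)
      have hp' := hd (P.Wplus t) (P.terminal t c * P.q ^ s)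
      rw [eval_Wminus P t 0] at hm
      rw [eval_Wplus P t 0] at hp'
      simp only [Pi.sub_apply]
      linear_combination P.weight t (P.q * (P.terminal t c * P.q ^ s)) * hm -
        P.weight t (P.terminal t c * P.q ^ s) * hp' + hp
    rw [eval_sub, h0₁, h0₂, ← jackson_sub hq1 (continuousAt_mul_eval hw' _)
      (continuousAt_mul_eval hw _), jackson, key, key, weight_terminal hq0 hb hb6 ht,
      weight_terminal hq0 hb hb6 ht, sub_self]
  · have hn := hx.offNodes hq0 hb a b
    have e1 := h₁ x hn
    have e2 := h₂ x hn
    have hs : P.stieltjes t a b (P.q * x) = jackson P.q (P.terminal t a) (P.terminal t b)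
        fun y => P.weight t (P.q * y) / (x - y) := by
      rw [stieltjes, ← jackson_shift hq1 (continuousAt_resolvent hw (mul_ne_zero hq0 hx.1))
        (by simp [weight_terminal hq0 hb hb6 ht]) (by simp [weight_terminal hq0 hb hb6 ht])]
      congr 1
      ext y
      rw [← mul_sub, mul_div_assoc', mul_div_mul_left _ _ hq0]
    have e3 : jackson P.q (P.terminal t a) (P.terminal t b)
        (fun y => P.weight t (P.q * y) * (P.Wminus t).eval y / (x - y)) =
        jackson P.q (P.terminal t a) (P.terminal t b)
        (fun y => P.weight t y * (P.Wplus t).eval y / (x - y)) := by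
      refine jackson_congr (fun s => ?_) (fun s => ?_) <;>
        rw [pearson_terminal hq0 hq1 hb hb6 ht hreg]
    rw [hs, eval_sub, stieltjes]
    linear_combination e2 - e1 + e3

lemma weight_shift_terminal (a : Fin 3 × ℕ) (s : ℕ) :
    P.weight (P.q * t) (P.terminal t a * P.q ^ s) *
        (P.b6 * (P.q * t - P.b6 * (P.terminal t a * P.q ^ s))) =
      P.weight t (P.terminal t a * P.q ^ s) * (P.b6 * P.q * t - P.terminal t a * P.q ^ s) := by
  refine weight_shift hq0 hq1 hb6 ht ?_
  have := terminal_shift_ne_zero hq0 hb hreg a s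
  rwa [zpow_natCast, mul_comm (P.q ^ s)] at this

lemma weight_shift_terminal_eq_zero (a : Fin 3 × ℕ) :
    P.weight (P.q * t) (P.terminal t a) = 0 := by
  have h := weight_shift_terminal hq0 hq1 hb hb6 ht hreg a 0
  have h' := terminal_shift_ne_zero hq0 hb hreg a 0
  simp only [pow_zero, mul_one, weight_terminal hq0 hb hb6 ht, zero_mul, zpow_zero, one_mul] at h h'
  exact (mul_eq_zero.mp h).resolve_right (mul_ne_zero hb6 h')

/-- The terminals of the time `q t` may be replaced by those of the time `t`. -/
lemma jackson_terminal_shift {h : ℂ → ℂ} (hh : ContinuousAt h 0)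
    (h0 : ∀ x, P.weight (P.q * t) x = 0 → h x = 0) (a b : Fin 3 × ℕ) :
    jackson P.q (P.terminal (P.q * t) a) (P.terminal (P.q * t) b) h =
      jackson P.q (P.terminal t a) (P.terminal t b) h := by
  have key : ∀ c, jacksonZero P.q (P.terminal (P.q * t) c) h =
      jacksonZero P.q (P.terminal t c) h := by
    intro c
    have hc := h0 _ (weight_shift_terminal_eq_zero hq0 hq1 hb hb6 ht hreg c)
    obtain ⟨i, k⟩ := c
    fin_cases i
    · rfl
    · rfl
    · rw [← jacksonZero_mul_terminal hq1 hh hc]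
      congr 1
      simp only [terminal, Fin.reduceFinMk, Matrix.cons_val]
      ring
  rw [jackson, jackson, key, key]

/-- Evolution in time of the Stieltjes transform. -/
lemma exists_stieltjes_shift (a b : Fin 3 × ℕ) : ∃ c : ℂ, ∀ x, P.OffLattice t x →
    P.b6 * (P.q * t - P.b6 * x) * P.stieltjes (P.q * t) a b x =
      (P.b6 * P.q * t - x) * P.stieltjes t a b x + c := by
  have hw := continuousAt_weight (P := P) hq1 t
  have hw' := continuousAt_weight (P := P) hq1 (P.q * t)
  refine ⟨-P.b6 ^ 2 * jackson P.q (P.terminal t a) (P.terminal t b) (P.weight (P.q * t)) +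
    jackson P.q (P.terminal t a) (P.terminal t b) (P.weight t), fun x hx => ?_⟩
  have hn := hx.offNodes hq0 hb a b
  have e1 := jackson_linear_resolvent hq1 hw' hn (P.b6 * (P.q * t)) (-P.b6 ^ 2)
  have e2 := jackson_linear_resolvent hq1 hw hn (P.b6 * P.q * t) (-1)
  have e3 : jackson P.q (P.terminal t a) (P.terminal t b)
      (fun y => P.weight (P.q * t) y * (P.b6 * (P.q * t) + -P.b6 ^ 2 * y) / (x - y)) =
      jackson P.q (P.terminal t a) (P.terminal t b)
      (fun y => P.weight t y * (P.b6 * P.q * t + -1 * y) / (x - y)) := by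
    refine jackson_congr (fun s => ?_) (fun s => ?_) <;> congr 1
    · linear_combination weight_shift_terminal hq0 hq1 hb hb6 ht hreg a s
    · linear_combination weight_shift_terminal hq0 hq1 hb hb6 ht hreg b s
  rw [stieltjes, stieltjes, jackson_terminal_shift hq0 hq1 hb hb6 ht hreg
    (continuousAt_resolvent hw' hx.1) (fun y hy => by rw [hy, zero_div])]
  linear_combination e3 - e1 + e2

end

end Params

/-! ### Orthogonal polynomials and associated functions -/

namespace Params

variable {P : Params} {t : ℂ} {a b : Fin 3 × ℕ} {p : ℕ → ℂ[X]}

lemma integral_eval_add (hq1 : ‖P.q‖ < 1) (g h : ℂ[X]) :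
    P.integral t a b (fun x => (g + h).eval x) =
      P.integral t a b (fun x => g.eval x) + P.integral t a b (fun x => h.eval x) := by
  have hw := continuousAt_weight (P := P) hq1 t
  simp only [integral, eval_add, mul_add]
  exact jackson_add hq1 (continuousAt_mul_eval hw g) (continuousAt_mul_eval hw h)

lemma integral_eval_C_mul (c : ℂ) (h : ℂ[X]) :
    P.integral t a b (fun x => (C c * h).eval x) = c * P.integral t a b (fun x => h.eval x) := by
  simp only [integral, eval_mul, eval_C, mul_left_comm _ c]
  exact jackson_const_mul c _

namespace IsOPS

lemma natDegree_eq (hp : P.IsOPS t a b p) (n : ℕ) : (p n).natDegree = n :=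
  natDegree_eq_of_degree_eq_some (hp.1 n)

lemma leadingCoeff_ne_zero (hp : P.IsOPS t a b p) (n : ℕ) : (p n).leadingCoeff ≠ 0 := by
  refine Polynomial.leadingCoeff_ne_zero.mpr fun h => ?_
  have := hp.1 n
  simp [h] at this

/-- A polynomial of degree at most `n` is a multiple of `p n` plus a polynomial of smaller
degree. -/
lemma degree_sub_lt (hp : P.IsOPS t a b p) {n : ℕ} {g : ℂ[X]} (hg : g.degree < (n + 1 : ℕ)) :
    (g - C (g.coeff n / (p n).leadingCoeff) * p n).degree < n := by
  rw [degree_lt_iff_coeff_zero] at hg ⊢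
  intro m hm
  have hl := hp.leadingCoeff_ne_zero n
  rw [coeff_sub, coeff_C_mul]
  rcases hm.eq_or_lt with rfl | hm
  · rw [leadingCoeff, hp.natDegree_eq] at *
    field_simp
    ring
  · rw [hg m hm, coeff_eq_zero_of_natDegree_lt (p := p n) (by rwa [hp.natDegree_eq])]
    ring

lemma integral_mul (hp : P.IsOPS t a b p) (m n : ℕ) :
    P.integral t a b (fun x => (p m * p n).eval x) = if m = n then 1 else 0 := by
  simpa only [eval_mul] using hp.2 m n

lemma integral_mul_eq_zero (hq1 : ‖P.q‖ < 1) (hp : P.IsOPS t a b p) {n m : ℕ} (hm : m ≤ n)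
    {g : ℂ[X]} (hg : g.degree < m) : P.integral t a b (fun x => (g * p n).eval x) = 0 := by
  induction m generalizing g with
  | zero =>
    have : g = 0 := by simpa using hg
    simp [this, integral, jackson, jacksonZero]
  | succ m ih =>
    have h1 := ih (by omega) (hp.degree_sub_lt hg)
    have h2 := hp.integral_mul m n
    rw [if_neg (by omega)] at h2
    have e : g * p n = (g - C (g.coeff m / (p m).leadingCoeff) * p m) * p n +
        C (g.coeff m / (p m).leadingCoeff) * (p m * p n) := by ring
    rw [e, integral_eval_add hq1, integral_eval_C_mul, h1, h2, mul_zero, add_zero]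

lemma integral_X_pow_mul (hq1 : ‖P.q‖ < 1) (hp : P.IsOPS t a b p) (n : ℕ) :
    P.integral t a b (fun x => (X ^ n * p n).eval x) = (p n).leadingCoeff⁻¹ := by
  have hX : (X ^ n : ℂ[X]).degree < (n + 1 : ℕ) := by
    rw [degree_X_pow]
    exact_mod_cast Nat.lt_succ_self n
  have h1 := hp.integral_mul_eq_zero hq1 le_rfl (hp.degree_sub_lt hX)
  have h2 := hp.integral_mul n n
  have e : X ^ n * p n = (X ^ n - C ((X ^ n : ℂ[X]).coeff n / (p n).leadingCoeff) * p n) * p n +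
      C ((X ^ n : ℂ[X]).coeff n / (p n).leadingCoeff) * (p n * p n) := by ring
  rw [e, integral_eval_add hq1, integral_eval_C_mul, h1, h2]
  simp

end IsOPS

lemma assoc_eq (P : Params) (t : ℂ) (a b : Fin 3 × ℕ) (p : ℕ → ℂ[X]) (n : ℕ) (x : ℂ) :
    P.assoc t a b p n x = jackson P.q (P.terminal t a) (P.terminal t b)
      (fun y => P.weight t y * (p n).eval y / (x - y)) := by
  simp only [assoc, integral, mul_div_assoc]

section

variable (hq0 : P.q ≠ 0) (hq1 : ‖P.q‖ < 1) (hb : P.b1 * P.b2 * P.b3 * P.b4 = 1)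
include hq0 hq1 hb

/-- Orthogonality lets powers of `x` up to the degree pass under the `q`-integral. -/
lemma pow_mul_assoc (hp : P.IsOPS t a b p) {n m : ℕ} (hm : m ≤ n) {x : ℂ}
    (hx : P.OffLattice t x) : x ^ m * P.assoc t a b p n x =
      jackson P.q (P.terminal t a) (P.terminal t b)
        (fun y => P.weight t y * (X ^ m * p n).eval y / (x - y)) := by
  induction m with
  | zero => simp [assoc_eq]
  | succ m ih =>
    have h := jackson_mul_resolvent hq1 (continuousAt_mul_eval (continuousAt_weight hq1 t)
      (X ^ m * p n)) (hx.offNodes hq0 hb a b)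
    have h0 : jackson P.q (P.terminal t a) (P.terminal t b)
        (fun y => P.weight t y * (X ^ m * p n).eval y) = 0 :=
      hp.integral_mul_eq_zero hq1 hm (by rw [degree_X_pow]; exact_mod_cast Nat.lt_succ_self m)
    rw [h0, ← ih (by omega), sub_zero] at h
    rw [pow_succ', mul_assoc, ← h]
    congr 1
    ext y
    simp only [eval_mul, eval_pow, eval_X]
    ring

/-- The leading behaviour of an associated function at infinity. -/
lemma tendsto_pow_mul_assoc (hp : P.IsOPS t a b p) (n : ℕ) :
    Tendsto (fun x => x ^ (n + 1) * P.assoc t a b p n x) (P.offLatticeAtInfinity t)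
      (𝓝 (p n).leadingCoeff⁻¹) := by
  have hw := continuousAt_weight (P := P) hq1 t
  have h0 := (tendsto_jackson_resolvent hq1 (continuousAt_mul_eval hw (X ^ (n + 1) * p n))
    (P.terminal t a) (P.terminal t b)).mono_left
      (offLatticeAtInfinity_le P t)
  have h1 := h0.add_const (p n).leadingCoeff⁻¹
  rw [zero_add] at h1
  refine h1.congr' ?_
  filter_upwards [eventually_offLattice P t] with x hx
  have h := jackson_mul_resolvent hq1 (continuousAt_mul_eval hw (X ^ n * p n))
    (hx.offNodes hq0 hb a b)
  have h2 : jackson P.q (P.terminal t a) (P.terminal t b)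
        (fun y => P.weight t y * (X ^ n * p n).eval y) = (p n).leadingCoeff⁻¹ :=
    hp.integral_X_pow_mul hq1 n
  rw [h2, ← pow_mul_assoc hq0 hq1 hb hp le_rfl hx] at h
  have e : ∀ y, P.weight t y * (X ^ (n + 1) * p n).eval y / (x - y) =
      P.weight t y * (X ^ n * p n).eval y * y / (x - y) := fun y => by
    simp only [eval_mul, eval_pow, eval_X]
    ring
  simp only [e, h]
  ring

/-- An associated function is, up to a polynomial, a polynomial multiple of the Stieltjes
transform. -/
lemma exists_assoc_eq (a b : Fin 3 × ℕ) (p : ℕ → ℂ[X]) (n : ℕ) : ∃ r : ℂ[X],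
    ∀ x, P.OffLattice t x →
      P.assoc t a b p n x = (p n).eval x * P.stieltjes t a b x - r.eval x := by
  obtain ⟨r, -, hr⟩ := exists_secondKind hq1 (continuousAt_weight (P := P) hq1 t)
    (P.terminal t a) (P.terminal t b) (p n)
  exact ⟨r, fun x hx => by rw [assoc_eq, hr x (hx.offNodes hq0 hb a b), stieltjes]⟩

end

end Params

/-! ### The polynomial gauge of the matrix variable -/

/-- The polynomials that express the matrix variable `Y_n` through the Stieltjes transform `F` of
the weight: the rows of `Y_n` are `(p, (p F - r) / w)` and `(p', (p' F - r') / w)`, where `p` stands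
for `p_n`, of degree `n` and leading coefficient `γ`, and `p'` for `p_{n-1}`. The constant `a`
stands for `a_n`, so that the leading coefficient of `p_{n-1}` is `a γ` if `n ≥ 1`, and `F`
satisfies an inhomogeneous Pearson equation with inhomogeneity `U`. Orthogonality enters only
through the decay at infinity of the functions `p F - r` and `p' F - r'` of the second kind. -/
structure Gauge (P : Params) (t : ℂ) (n : ℕ) (F : ℂ → ℂ) where
  p : ℂ[X]
  p' : ℂ[X]
  r : ℂ[X]
  r' : ℂ[X]
  U : ℂ[X]
  a : ℂ
  γ : ℂ
  a_ne : a ≠ 0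
  γ_ne : γ ≠ 0
  natDegree_p : p.natDegree ≤ n
  coeff_p : p.coeff n = γ
  natDegree_p' : p'.natDegree ≤ n
  coeff_p' : p'.coeff n = 0
  tendsto_second : Tendsto (fun x => x ^ (n + 1) * (p.eval x * F x - r.eval x))
    (P.offLatticeAtInfinity t) (𝓝 γ⁻¹)
  tendsto_second' : Tendsto (fun x => x ^ n * (p'.eval x * F x - r'.eval x))
    (P.offLatticeAtInfinity t) (𝓝 (a * γ)⁻¹)
  eval_U : U.eval 0 = 0
  pearson : ∀ x, P.OffLattice t x →
    (P.Wminus t).eval x * F (P.q * x) = (P.Wplus t).eval x * F x + U.eval x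

namespace Params

variable {P : Params} {t : ℂ} {a b : Fin 3 × ℕ} {p : ℕ → ℂ[X]}

lemma recA_ne_zero (hp : P.IsOPS t a b p) {a₀ : ℂ} (ha₀ : a₀ ≠ 0) (n : ℕ) : recA a₀ p n ≠ 0 := by
  cases n with
  | zero => exact ha₀
  | succ n => exact div_ne_zero (hp.leadingCoeff_ne_zero n) (hp.leadingCoeff_ne_zero (n + 1))

lemma exists_gauge (hq0 : P.q ≠ 0) (hq1 : ‖P.q‖ < 1) (hb : P.b1 * P.b2 * P.b3 * P.b4 = 1)
    (hb6 : P.b6 ≠ 0) (ht : t ≠ 0) (hreg : P.Regular t) (hp : P.IsOPS t a b p) {a₀ : ℂ}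
    (ha₀ : a₀ ≠ 0) (n : ℕ) :
    ∃ G : Gauge P t n (P.stieltjes t a b),
      G.a = recA a₀ p n ∧ G.p = p n ∧ G.p' = prevPoly p n ∧ ∀ x, P.OffLattice t x →
        P.assoc t a b p n x = G.p.eval x * P.stieltjes t a b x - G.r.eval x ∧
        P.prevAssoc t a b a₀ p n x = G.p'.eval x * P.stieltjes t a b x - G.r'.eval x := by
  obtain ⟨U, hU0, hU⟩ := exists_stieltjes_pearson hq0 hq1 hb hb6 ht hreg a b
  obtain ⟨r, hr⟩ := exists_assoc_eq hq0 hq1 hb (t := t) a b p n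
  have hprev : ∃ r' : ℂ[X], (∀ x, P.OffLattice t x → P.prevAssoc t a b a₀ p n x =
      (prevPoly p n).eval x * P.stieltjes t a b x - r'.eval x) ∧
      Tendsto (fun x => x ^ n * P.prevAssoc t a b a₀ p n x) (P.offLatticeAtInfinity t)
        (𝓝 (recA a₀ p n * (p n).leadingCoeff)⁻¹) ∧
      (prevPoly p n).natDegree ≤ n ∧ (prevPoly p n).coeff n = 0 := by
    cases n with
    | zero =>
      refine ⟨C (-(1 / (a₀ * (p 0).leadingCoeff))), fun x _ => ?_, ?_, ?_, ?_⟩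
      · simp [prevAssoc, prevPoly]
      · simpa [prevAssoc, recA] using tendsto_const_nhds
      · simp [prevPoly]
      · simp [prevPoly]
    | succ n =>
      obtain ⟨r', hr'⟩ := exists_assoc_eq hq0 hq1 hb (t := t) a b p n
      refine ⟨r', hr', ?_, ?_, ?_⟩
      · rw [recA, div_mul_cancel₀ _ (hp.leadingCoeff_ne_zero (n + 1))]
        exact tendsto_pow_mul_assoc hq0 hq1 hb hp n
      · rw [prevPoly, hp.natDegree_eq]
        exact Nat.le_succ n
      · refine coeff_eq_zero_of_natDegree_lt ?_
        rw [prevPoly, hp.natDegree_eq]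
        exact Nat.lt_succ_self n
  obtain ⟨r', hr', ht', hd', hc'⟩ := hprev
  refine ⟨⟨p n, prevPoly p n, r, r', U, recA a₀ p n, (p n).leadingCoeff, recA_ne_zero hp ha₀ n,
    hp.leadingCoeff_ne_zero n, (hp.natDegree_eq n).le, ?_, hd', hc', ?_, ?_, hU0, hU⟩, rfl, rfl,
    rfl, fun x hx => ⟨hr x hx, hr' x hx⟩⟩
  · rw [leadingCoeff, hp.natDegree_eq]
  · refine (tendsto_pow_mul_assoc hq0 hq1 hb hp n).congr' ?_
    filter_upwards [eventually_offLattice P t] with x hx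
    rw [hr x hx]
  · refine ht'.congr' ?_
    filter_upwards [eventually_offLattice P t] with x hx
    rw [hr' x hx]

end Params

/-! ### The transfer matrix in the spatial direction -/

/-- The substitution `x ↦ q x` in polynomials. -/
noncomputable def dilate (q : ℂ) : ℂ[X] →+* ℂ[X] := compRingHom (C q * X)

@[simp] lemma eval_dilate (q : ℂ) (Q : ℂ[X]) (x : ℂ) : (dilate q Q).eval x = Q.eval (q * x) := by
  simp [dilate]

namespace Gauge

variable {P : Params} {t : ℂ} {n : ℕ} {F : ℂ → ℂ} (G : Gauge P t n F)

/-- The polynomial matrix `M` with `Y = M (1, F / w; 0, 1 / w)`. -/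
noncomputable def mat : Matrix (Fin 2) (Fin 2) ℂ[X] := !![G.p, -G.r; G.p', -G.r']

/-- The inverse of `mat`. -/
noncomputable def matInv : Matrix (Fin 2) (Fin 2) ℂ[X] :=
  !![-(C G.a * G.r'), C G.a * G.r; -(C G.a * G.p'), C G.a * G.p]

/-- The polynomial matrix `K` with `(W + Δy V)(x) Y(q x) = K(x) Y(x)`. -/
noncomputable def transfer : Matrix (Fin 2) (Fin 2) ℂ[X] :=
  (dilate P.q).mapMatrix G.mat * !![P.Wplus t, G.U; 0, P.Wminus t] * G.matInv

lemma tendsto_p : Tendsto (fun x => G.p.eval x / x ^ n) (P.offLatticeAtInfinity t) (𝓝 G.γ) := by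
  simpa [G.coeff_p] using tendsto_eval_div_pow (P.offLatticeAtInfinity_le t) G.natDegree_p

lemma tendsto_p' : Tendsto (fun x => G.p'.eval x / x ^ n) (P.offLatticeAtInfinity t) (𝓝 0) := by
  simpa [G.coeff_p'] using tendsto_eval_div_pow (P.offLatticeAtInfinity_le t) G.natDegree_p'

/-- The Casoratian of the orthogonal polynomials and their associated functions. -/
lemma casoratian [(P.offLatticeAtInfinity t).NeBot] : C G.a * (G.p' * G.r - G.p * G.r') = 1 := by
  have h1 := G.tendsto_p.mul G.tendsto_second'
  have h2 := (G.tendsto_p'.mul G.tendsto_second).mul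
    (tendsto_inv₀_cobounded.mono_left (P.offLatticeAtInfinity_le t))
  have h3 : Tendsto (fun x => (G.p' * G.r - G.p * G.r').eval x / x ^ 0)
      (P.offLatticeAtInfinity t) (𝓝 G.a⁻¹) := by
    have h := h1.sub h2
    have e : G.γ * (G.a * G.γ)⁻¹ - 0 * G.γ⁻¹ * 0 = G.a⁻¹ := by
      have := G.γ_ne
      have := G.a_ne
      field_simp
      simp
    rw [e] at h
    refine h.congr' ?_
    filter_upwards [Params.eventually_offLattice P t] with x hx
    have := hx.1
    simp only [eval_sub, eval_mul]
    field_simp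
    ring
  obtain ⟨hd, hc⟩ := natDegree_le_of_tendsto (P.offLatticeAtInfinity_le t) h3
  rw [eq_C_of_natDegree_le_zero hd, hc, ← C_mul, mul_inv_cancel₀ G.a_ne, C_1]

lemma mat_mul_matInv [(P.offLatticeAtInfinity t).NeBot] : G.mat * G.matInv = 1 := by
  have h := G.casoratian
  rw [mat, matInv]
  refine Matrix.ext fun i j => ?_
  fin_cases i <;> fin_cases j <;> simp [Matrix.mul_apply, Fin.sum_univ_two]
  · linear_combination h
  · ring
  · ring
  · linear_combination h

lemma matInv_mul_mat [(P.offLatticeAtInfinity t).NeBot] : G.matInv * G.mat = 1 :=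
  mul_eq_one_comm.mp G.mat_mul_matInv

lemma transfer_mul_mat [(P.offLatticeAtInfinity t).NeBot] : G.transfer * G.mat =
    (dilate P.q).mapMatrix G.mat * !![P.Wplus t, G.U; 0, P.Wminus t] := by
  rw [transfer, Matrix.mul_assoc, G.matInv_mul_mat, Matrix.mul_one]

lemma det_mat [(P.offLatticeAtInfinity t).NeBot] : G.mat.det = C (G.a)⁻¹ := by
  have h := G.casoratian
  have ha : (C G.a⁻¹ * C G.a : ℂ[X]) = 1 := by rw [← C_mul, inv_mul_cancel₀ G.a_ne, C_1]
  rw [mat, Matrix.det_fin_two_of]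
  linear_combination C G.a⁻¹ * h - (G.p' * G.r - G.p * G.r') * ha

lemma det_matInv [(P.offLatticeAtInfinity t).NeBot] : G.matInv.det = C G.a := by
  have h := G.casoratian
  rw [matInv, Matrix.det_fin_two_of]
  linear_combination C G.a * h

lemma det_transfer [(P.offLatticeAtInfinity t).NeBot] :
    G.transfer.det = P.Wplus t * P.Wminus t := by
  have ha : (C G.a⁻¹ * C G.a : ℂ[X]) = 1 := by rw [← C_mul, inv_mul_cancel₀ G.a_ne, C_1]
  have h : ((dilate P.q).mapMatrix G.mat).det = C (G.a)⁻¹ := by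
    rw [← RingHom.map_det, det_mat]
    simp [dilate]
  rw [transfer, Matrix.det_mul, Matrix.det_mul, h, det_matInv, Matrix.det_fin_two_of]
  linear_combination P.Wplus t * P.Wminus t * ha

lemma transfer_eq : G.transfer =
    !![C G.a * ((dilate P.q G.r * P.Wminus t - dilate P.q G.p * G.U) * G.p' -
        dilate P.q G.p * P.Wplus t * G.r'),
      C G.a * (dilate P.q G.p * P.Wplus t * G.r -
        (dilate P.q G.r * P.Wminus t - dilate P.q G.p * G.U) * G.p);
      C G.a * ((dilate P.q G.r' * P.Wminus t - dilate P.q G.p' * G.U) * G.p' -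
        dilate P.q G.p' * P.Wplus t * G.r'),
      C G.a * (dilate P.q G.p' * P.Wplus t * G.r -
        (dilate P.q G.r' * P.Wminus t - dilate P.q G.p' * G.U) * G.p)] := by
  rw [transfer, mat, matInv]
  refine Matrix.ext fun i j => ?_
  fin_cases i <;> fin_cases j <;> simp [Matrix.mul_apply, Fin.sum_univ_two] <;> ring

/-- At the fixed point `0` of the lattice the transfer matrix is the scalar `b₆ t`. -/
lemma eval_zero_transfer [(P.offLatticeAtInfinity t).NeBot] :
    (G.transfer 0 0).eval 0 = P.b6 * t ∧ (G.transfer 0 1).eval 0 = 0 ∧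
    (G.transfer 1 0).eval 0 = 0 ∧ (G.transfer 1 1).eval 0 = P.b6 * t := by
  have h := congrArg (Polynomial.eval 0) G.casoratian
  simp only [eval_mul, eval_C, eval_sub, eval_one] at h
  have h1 : (P.Wplus t).eval 0 = P.b6 * t := by simp [Params.eval_Wplus]
  have h2 : (P.Wminus t).eval 0 = P.b6 * t := by simp [Params.eval_Wminus]
  rw [G.transfer_eq]
  simp only [Matrix.cons_val', Matrix.cons_val_zero, Matrix.cons_val_one, Matrix.of_apply,
    Matrix.cons_val_fin_one, eval_mul, eval_sub, eval_C, eval_dilate, mul_zero, h1, h2, G.eval_U]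
  refine ⟨?_, ?_, ?_, ?_⟩
  · linear_combination P.b6 * t * h
  · ring
  · ring
  · linear_combination P.b6 * t * h

end Gauge

/-! ### Degrees and leading coefficients of the transfer matrix -/

lemma Params.tendsto_Wplus (P : Params) (t : ℂ) {l : Filter ℂ} (hl : l ≤ cobounded ℂ) :
    Tendsto (fun x => (P.Wplus t).eval x / x ^ 3) l (𝓝 (-(P.b1 * P.b4 * P.b6 ^ 2))) := by
  have e : P.Wplus t = C (-(P.b1 * P.b4 * P.b6 ^ 2)) * X ^ 3 +
      C (P.b6 * (P.b1 * P.b4 * t + (P.b1 + P.b4) * P.b6)) * X ^ 2 +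
      C (-(P.b6 * ((P.b1 + P.b4) * t + P.b6))) * X + C (P.b6 * t) := by
    simp only [Wplus, map_neg, map_mul, map_add, map_pow]
    ring
  have hd : (P.Wplus t).natDegree ≤ 3 := by rw [e]; exact natDegree_cubic_le
  have hc : (P.Wplus t).coeff 3 = -(P.b1 * P.b4 * P.b6 ^ 2) := by
    rw [e]
    simp only [coeff_add, coeff_C_mul, coeff_X_pow, coeff_X, coeff_C]
    norm_num
  simpa [hc] using tendsto_eval_div_pow hl hd

lemma Params.tendsto_Wminus (P : Params) (t : ℂ) {l : Filter ℂ} (hl : l ≤ cobounded ℂ) :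
    Tendsto (fun x => (P.Wminus t).eval x / x ^ 3) l (𝓝 (-(P.b2 * P.b3))) := by
  have e : P.Wminus t = C (-(P.b2 * P.b3)) * X ^ 3 +
      C (P.b2 * P.b3 * (P.b6 * t) + (P.b2 + P.b3)) * X ^ 2 +
      C (-((P.b2 + P.b3) * (P.b6 * t) + 1)) * X + C (P.b6 * t) := by
    simp only [Wminus, map_neg, map_mul, map_add, map_one]
    ring
  have hd : (P.Wminus t).natDegree ≤ 3 := by rw [e]; exact natDegree_cubic_le
  have hc : (P.Wminus t).coeff 3 = -(P.b2 * P.b3) := by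
    rw [e]
    simp only [coeff_add, coeff_C_mul, coeff_X_pow, coeff_X, coeff_C]
    norm_num
  simpa [hc] using tendsto_eval_div_pow hl hd

namespace Gauge

variable {P : Params} {t : ℂ} {n : ℕ} {F : ℂ → ℂ} (G : Gauge P t n F)

lemma tendsto_dilate_div_pow (hq0 : P.q ≠ 0) {Q : ℂ[X]} {c : ℂ}
    (h : Tendsto (fun x => Q.eval x / x ^ n) (P.offLatticeAtInfinity t) (𝓝 c)) :
    Tendsto (fun x => (dilate P.q Q).eval x / x ^ n) (P.offLatticeAtInfinity t)
      (𝓝 (P.q ^ n * c)) := by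
  refine ((h.comp (Params.tendsto_mul_offLatticeAtInfinity hq0 t)).const_mul _).congr fun x => ?_
  have := pow_ne_zero n hq0
  simp only [Function.comp, eval_dilate, mul_pow]
  field_simp

lemma tendsto_pow_mul_dilate (hq0 : P.q ≠ 0) {m : ℕ} {f : ℂ → ℂ} {c : ℂ}
    (h : Tendsto (fun x => x ^ m * f x) (P.offLatticeAtInfinity t) (𝓝 c)) :
    Tendsto (fun x => x ^ m * f (P.q * x)) (P.offLatticeAtInfinity t)
      (𝓝 ((P.q ^ m)⁻¹ * c)) := by
  refine ((h.comp (Params.tendsto_mul_offLatticeAtInfinity hq0 t)).const_mul _).congr fun x => ?_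
  have := pow_ne_zero m hq0
  simp only [Function.comp, mul_pow]
  field_simp

section

variable [(P.offLatticeAtInfinity t).NeBot] (hq0 : P.q ≠ 0)
include hq0

lemma natDegree_transfer_zero_zero : (G.transfer 0 0).natDegree ≤ 3 ∧
    (G.transfer 0 0).coeff 3 = -(P.q ^ n * P.b1 * P.b4 * P.b6 ^ 2) := by
  refine natDegree_le_of_tendsto (l := P.offLatticeAtInfinity t) (P.offLatticeAtInfinity_le t) ?_
  have h1 := ((P.tendsto_Wplus t (P.offLatticeAtInfinity_le t)).mul
    (tendsto_dilate_div_pow hq0 G.tendsto_p)).mul G.tendsto_second'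
  have h2 := (((P.tendsto_Wminus t (P.offLatticeAtInfinity_le t)).mul
    (tendsto_pow_mul_dilate hq0 G.tendsto_second)).mul G.tendsto_p').mul
      (tendsto_inv₀_cobounded.mono_left (P.offLatticeAtInfinity_le t))
  have h := (h1.sub h2).const_mul G.a
  have e : G.a * (-(P.b1 * P.b4 * P.b6 ^ 2) * (P.q ^ n * G.γ) * (G.a * G.γ)⁻¹ -
      -(P.b2 * P.b3) * ((P.q ^ (n + 1))⁻¹ * G.γ⁻¹) * 0 * 0) =
      -(P.q ^ n * P.b1 * P.b4 * P.b6 ^ 2) := by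
    have := G.γ_ne
    have := G.a_ne
    field_simp
    ring
  rw [e] at h
  refine h.congr' ?_
  filter_upwards [Params.eventually_offLattice P t] with x hx
  have hx0 := hx.1
  have hU := G.pearson x hx
  rw [G.transfer_eq]
  simp only [Matrix.cons_val', Matrix.cons_val_zero, Matrix.of_apply, Matrix.cons_val_fin_one,
    eval_mul, eval_sub, eval_C, eval_dilate]
  generalize P.q * x = y at hU ⊢
  field_simp
  linear_combination -(G.a * x * x ^ n * G.p.eval y * G.p'.eval x) * hU

lemma natDegree_transfer_zero_one : (G.transfer 0 1).natDegree ≤ 2 ∧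
    (G.transfer 0 1).coeff 2 =
      G.a * (P.q ^ n * P.b1 * P.b4 * P.b6 ^ 2 - P.b2 * P.b3 * (P.q ^ (n + 1))⁻¹) := by
  refine natDegree_le_of_tendsto (l := P.offLatticeAtInfinity t) (P.offLatticeAtInfinity_le t) ?_
  have h1 := ((P.tendsto_Wplus t (P.offLatticeAtInfinity_le t)).mul
    (tendsto_dilate_div_pow hq0 G.tendsto_p)).mul G.tendsto_second
  have h2 := (((P.tendsto_Wminus t (P.offLatticeAtInfinity_le t)).mul
    (tendsto_pow_mul_dilate hq0 G.tendsto_second)).mul G.tendsto_p)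
  have h := (h2.sub h1).const_mul G.a
  have e : G.a * (-(P.b2 * P.b3) * ((P.q ^ (n + 1))⁻¹ * G.γ⁻¹) * G.γ -
      -(P.b1 * P.b4 * P.b6 ^ 2) * (P.q ^ n * G.γ) * G.γ⁻¹) =
      G.a * (P.q ^ n * P.b1 * P.b4 * P.b6 ^ 2 - P.b2 * P.b3 * (P.q ^ (n + 1))⁻¹) := by
    have := G.γ_ne
    field_simp
    ring
  rw [e] at h
  refine h.congr' ?_
  filter_upwards [Params.eventually_offLattice P t] with x hx
  have hx0 := hx.1
  have hU := G.pearson x hx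
  rw [G.transfer_eq]
  simp only [Matrix.cons_val', Matrix.cons_val_zero, Matrix.cons_val_one, Matrix.of_apply,
    Matrix.cons_val_fin_one, eval_mul, eval_sub, eval_C, eval_dilate]
  generalize P.q * x = y at hU ⊢
  field_simp
  linear_combination G.a * x * x ^ n * G.p.eval y * G.p.eval x * hU

lemma natDegree_transfer_one_one : (G.transfer 1 1).natDegree ≤ 3 ∧
    (G.transfer 1 1).coeff 3 = -(P.b2 * P.b3 * (P.q ^ n)⁻¹) := by
  refine natDegree_le_of_tendsto (l := P.offLatticeAtInfinity t) (P.offLatticeAtInfinity_le t) ?_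
  have h1 := (((P.tendsto_Wplus t (P.offLatticeAtInfinity_le t)).mul
    (tendsto_dilate_div_pow hq0 G.tendsto_p')).mul G.tendsto_second).mul
      (tendsto_inv₀_cobounded.mono_left (P.offLatticeAtInfinity_le t))
  have h2 := (((P.tendsto_Wminus t (P.offLatticeAtInfinity_le t)).mul
    (tendsto_pow_mul_dilate hq0 G.tendsto_second')).mul G.tendsto_p)
  have h := (h2.sub h1).const_mul G.a
  have e : G.a * (-(P.b2 * P.b3) * ((P.q ^ n)⁻¹ * (G.a * G.γ)⁻¹) * G.γ -
      -(P.b1 * P.b4 * P.b6 ^ 2) * (P.q ^ n * 0) * G.γ⁻¹ * 0) = -(P.b2 * P.b3 * (P.q ^ n)⁻¹) := by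
    have := G.γ_ne
    have := G.a_ne
    field_simp
    ring
  rw [e] at h
  refine h.congr' ?_
  filter_upwards [Params.eventually_offLattice P t] with x hx
  have hx0 := hx.1
  have hU := G.pearson x hx
  rw [G.transfer_eq]
  simp only [Matrix.cons_val', Matrix.cons_val_one, Matrix.of_apply,
    Matrix.cons_val_fin_one, eval_mul, eval_sub, eval_C, eval_dilate]
  generalize P.q * x = y at hU ⊢
  field_simp
  linear_combination G.a * x * x ^ n * G.p'.eval y * G.p.eval x * hU

end

end Gauge

/-! ### Spectral coefficients and the transfer matrix -/

lemma eval_mapMatrix_dilate (q x : ℂ) (M : Matrix (Fin 2) (Fin 2) ℂ[X]) :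
    (evalRingHom x).mapMatrix ((dilate q).mapMatrix M) = (evalRingHom (q * x)).mapMatrix M := by
  refine Matrix.ext fun i j => ?_
  simp

/-- The divided-difference equation at a point, in terms of the transfer matrix `K`. -/
lemma dividedDiff_eq_iff {Y Yq K N : Matrix (Fin 2) (Fin 2) ℂ} {w δ wp : ℂ} (hδ : δ ≠ 0)
    (hwp : wp ≠ 0) (hK : wp • Yq = K * Y) (hY : IsUnit Y) :
    w • (δ⁻¹ • (Yq - Y)) = N * ((1 / 2 : ℂ) • (Yq + Y)) ↔
      ((2 * w) • 1 - δ • N) * K = wp • ((2 * w) • 1 + δ • N) := by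
  have key : ((2 * w) • 1 - δ • N) * K = wp • ((2 * w) • 1 + δ • N) ↔
      ((2 * w) • 1 - δ • N) * K * Y = wp • ((2 * w) • 1 + δ • N) * Y := hY.mul_left_inj.symm
  rw [key, Matrix.mul_assoc, ← hK, Matrix.mul_smul _ wp Yq, smul_mul_assoc wp,
    (smul_right_injective _ hwp).eq_iff, sub_mul, add_mul]
  simp only [smul_mul_assoc, one_mul, Matrix.mul_smul, Matrix.mul_add]
  generalize N * Yq = A
  generalize N * Y = B
  simp only [← Matrix.ext_iff, Matrix.smul_apply, Matrix.sub_apply, Matrix.add_apply, smul_eq_mul]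
  refine forall_congr' fun i => forall_congr' fun j => ⟨fun h => ?_, fun h => ?_⟩
  · field_simp at h
    linear_combination h
  · field_simp
    linear_combination h

/-- Cayley transform: the transfer matrix determines and is determined by the coefficient matrix
of the divided-difference equation. -/
lemma transfer_of_cayley {R : Type*} [CommRing R] [IsDomain R]
    {W V δ w o u v k₁₁ k₁₂ k₂₁ k₂₂ : R} (hne : 4 * w * (W + δ * V) ≠ 0)
    (hquad : 4 * w * (w - W) = -(δ ^ 2 * (o * (-o - 2 * V) + u * v)))
    (e₁₁ : (2 * w - δ * o) * k₁₁ + δ * u * k₂₁ = (W + δ * V) * (2 * w + δ * o))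
    (e₁₂ : (2 * w - δ * o) * k₁₂ + δ * u * k₂₂ = (W + δ * V) * -(δ * u))
    (e₂₁ : -(δ * v) * k₁₁ + (2 * w + δ * (o + 2 * V)) * k₂₁ = (W + δ * V) * (δ * v))
    (e₂₂ : -(δ * v) * k₁₂ + (2 * w + δ * (o + 2 * V)) * k₂₂ =
      (W + δ * V) * (2 * w - δ * (o + 2 * V))) :
    k₁₁ = 2 * w - W + δ * (o + V) ∧ k₁₂ = -(δ * u) ∧ k₂₁ = δ * v ∧
      k₂₂ = 2 * w - W - δ * (o + V) := by
  refine ⟨?_, ?_, ?_, ?_⟩ <;> refine mul_left_cancel₀ hne ?_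
  · linear_combination (2 * w + δ * (o + 2 * V)) * e₁₁ - δ * u * e₂₁ + (-k₁₁ - (W + δ * V)) * hquad
  · linear_combination (2 * w + δ * (o + 2 * V)) * e₁₂ - δ * u * e₂₂ - k₁₂ * hquad
  · linear_combination δ * v * e₁₁ + (2 * w - δ * o) * e₂₁ - k₂₁ * hquad
  · linear_combination δ * v * e₁₂ + (2 * w - δ * o) * e₂₂ + (-k₂₂ - (W + δ * V)) * hquad

namespace Gauge

variable {P : Params} {t : ℂ} {n : ℕ} {F : ℂ → ℂ} (G : Gauge P t n F)

/-- `G` is a gauge of the matrix-valued function `Y`. -/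
def Represents (Y : ℂ → Matrix (Fin 2) (Fin 2) ℂ) : Prop :=
  ∀ x, P.OffLattice t x → Y x = (evalRingHom x).mapMatrix G.mat *
    !![1, F x / P.weight t x; 0, 1 / P.weight t x]

variable {G} {Y : ℂ → Matrix (Fin 2) (Fin 2) ℂ}

section

variable [(P.offLatticeAtInfinity t).NeBot] (hq0 : P.q ≠ 0) (hq1 : ‖P.q‖ < 1) (hb6 : P.b6 ≠ 0)
  (ht : t ≠ 0)
include hq1 hb6 ht

lemma Represents.isUnit (h : G.Represents Y) {x : ℂ} (hx : P.OffLattice t x) : IsUnit (Y x) := by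
  rw [h x hx]
  refine IsUnit.mul ?_ ?_
  · refine IsUnit.map _ ?_
    exact IsUnit.of_mul_eq_one _ G.mat_mul_matInv
  · rw [Matrix.isUnit_iff_isUnit_det, Matrix.det_fin_two_of]
    simpa using hx.weight_ne_zero hq1 hb6 ht

include hq0

/-- The transfer matrix shifts `Y` in the spatial direction. -/
lemma Represents.smul_shift (h : G.Represents Y) {x : ℂ} (hx : P.OffLattice t x) :
    (P.Wplus t).eval x • Y (P.q * x) = (evalRingHom x).mapMatrix G.transfer * Y x := by
  have hx' : P.OffLattice t (P.q * x) := by simpa using hx.zpow_mul hq0 1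
  have hw := hx.weight_ne_zero hq1 hb6 ht
  have hw' := hx'.weight_ne_zero hq1 hb6 ht
  have hp := Params.pearson hq1 hb6 ht hx.eval_Wplus_ne_zero
  have hU := G.pearson x hx
  rw [h x hx, h _ hx', ← Matrix.mul_assoc, ← map_mul, G.transfer_mul_mat, map_mul,
    eval_mapMatrix_dilate, Matrix.mul_assoc, ← Matrix.mul_smul]
  congr 1
  refine Matrix.ext fun i j => ?_
  fin_cases i <;> fin_cases j <;> simp [Matrix.mul_apply, Fin.sum_univ_two]
  · field_simp
    generalize P.q * x = y at hp hU hw' ⊢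
    linear_combination P.weight t y * hU - F y * hp
  · field_simp
    linear_combination -hp

end

end Gauge

namespace Params

variable {P : Params} {t : ℂ}

lemma Wplus_eq (hq1 : ‖P.q‖ < 1) (t : ℂ) : P.Wplus t = P.W t + P.deltaY * P.V t := by
  rw [P.deltaY_mul_V (by rintro h; simp [h] at hq1), W]
  have h : (C (1 / 2) + C (1 / 2) : ℂ[X]) = 1 := by rw [← C_add, add_halves, C_1]
  linear_combination -P.Wplus t * h

lemma Wminus_eq (hq1 : ‖P.q‖ < 1) (t : ℂ) : P.Wminus t = P.W t - P.deltaY * P.V t := by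
  rw [P.deltaY_mul_V (by rintro h; simp [h] at hq1), W]
  have h : (C (1 / 2) + C (1 / 2) : ℂ[X]) = 1 := by rw [← C_add, add_halves, C_1]
  linear_combination -P.Wminus t * h

lemma eval_deltaY (P : Params) (x : ℂ) : P.deltaY.eval x = P.q * x - x := by
  rw [deltaY, eval_mul, eval_C, eval_X]
  ring

lemma deltaY_ne_zero (hq1 : ‖P.q‖ < 1) : P.deltaY ≠ 0 := by
  refine mul_ne_zero (C_ne_zero.mpr (sub_ne_zero.mpr ?_)) X_ne_zero
  rintro h
  simp [h] at hq1

lemma Wplus_ne_zero (hb6 : P.b6 ≠ 0) (ht : t ≠ 0) : P.Wplus t ≠ 0 := by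
  intro h
  have := congrArg (Polynomial.eval 0) h
  simp [eval_Wplus, hb6, ht] at this

lemma exists_representing_gauge (hq0 : P.q ≠ 0) (hq1 : ‖P.q‖ < 1)
    (hb : P.b1 * P.b2 * P.b3 * P.b4 = 1) (hb6 : P.b6 ≠ 0) (ht : t ≠ 0) (hreg : P.Regular t)
    {a b : Fin 3 × ℕ} {p : ℕ → ℂ[X]} (hp : P.IsOPS t a b p) {a₀ : ℂ} (ha₀ : a₀ ≠ 0) (n : ℕ) :
    ∃ G : Gauge P t n (P.stieltjes t a b),
      G.a = recA a₀ p n ∧ G.Represents (P.Y t a b a₀ p n) := by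
  obtain ⟨G, hGa, hGp, hGp', hG⟩ := exists_gauge hq0 hq1 hb hb6 ht hreg hp ha₀ n
  refine ⟨G, hGa, fun x hx => ?_⟩
  obtain ⟨h1, h2⟩ := hG x hx
  rw [Y, h1, h2, ← hGp, ← hGp']
  refine Matrix.ext fun i j => ?_
  fin_cases i <;> fin_cases j <;> simp [Matrix.mul_apply, Fin.sum_univ_two, Gauge.mat] <;> ring

end Params

namespace Gauge

variable {P : Params} {t : ℂ} {n : ℕ} {F : ℂ → ℂ} {G : Gauge P t n F}
  {a b : Fin 3 × ℕ} {p : ℕ → ℂ[X]} {a₀ : ℂ}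

/-- At a point off the lattices, the divided-difference equation is an identity between the
coefficient matrix and the transfer matrix. -/
lemma isSpectral_at_iff [(P.offLatticeAtInfinity t).NeBot] (hq0 : P.q ≠ 0) (hq1 : ‖P.q‖ < 1)
    (hb6 : P.b6 ≠ 0) (ht : t ≠ 0) (hGa : G.a = Params.recA a₀ p n)
    (hG : G.Represents (P.Y t a b a₀ p n)) (S : SpectralCoeffs) {x : ℂ}
    (hx : P.OffLattice t x) :
    S.Wn.eval x • dividedDiff P.q (P.Y t a b a₀ p n) x =
      !![S.Om.eval x, -(Params.recA a₀ p n) * S.Th.eval x;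
         Params.recA a₀ p n * S.ThPrev.eval x, -S.Om.eval x - 2 * (P.V t).eval x] *
        meanOp P.q (P.Y t a b a₀ p n) x ↔
      ((2 * S.Wn - P.deltaY * S.Om) * G.transfer 0 0 +
          P.deltaY * (C G.a * S.Th) * G.transfer 1 0).eval x =
        (P.Wplus t * (2 * S.Wn + P.deltaY * S.Om)).eval x ∧
      ((2 * S.Wn - P.deltaY * S.Om) * G.transfer 0 1 +
          P.deltaY * (C G.a * S.Th) * G.transfer 1 1).eval x =
        (P.Wplus t * -(P.deltaY * (C G.a * S.Th))).eval x ∧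
      (-(P.deltaY * (C G.a * S.ThPrev)) * G.transfer 0 0 +
          (2 * S.Wn + P.deltaY * (S.Om + 2 * P.V t)) * G.transfer 1 0).eval x =
        (P.Wplus t * (P.deltaY * (C G.a * S.ThPrev))).eval x ∧
      (-(P.deltaY * (C G.a * S.ThPrev)) * G.transfer 0 1 +
          (2 * S.Wn + P.deltaY * (S.Om + 2 * P.V t)) * G.transfer 1 1).eval x =
        (P.Wplus t * (2 * S.Wn - P.deltaY * (S.Om + 2 * P.V t))).eval x := by
  have hδ : P.q * x - x ≠ 0 := by
    rw [← sub_one_mul]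
    refine mul_ne_zero (sub_ne_zero.mpr ?_) hx.1
    rintro h
    simp [h] at hq1
  rw [dividedDiff, meanOp, dividedDiff_eq_iff hδ hx.eval_Wplus_ne_zero
    (hG.smul_shift hq0 hq1 hb6 ht hx) (hG.isUnit hq1 hb6 ht hx), ← Matrix.ext_iff]
  simp only [Fin.forall_fin_two, and_assoc]
  simp only [Matrix.mul_apply, Fin.sum_univ_two, Matrix.sub_apply, Matrix.add_apply,
    Matrix.smul_apply, Matrix.one_apply_eq, Matrix.one_apply_ne zero_ne_one,
    Matrix.one_apply_ne one_ne_zero, Matrix.of_apply, Matrix.cons_val', Matrix.cons_val_zero,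
    Matrix.cons_val_one, Matrix.cons_val_fin_one, RingHom.mapMatrix_apply, Matrix.map_apply,
    coe_evalRingHom, smul_eq_mul, eval_add, eval_sub, eval_mul, eval_neg, eval_C, eval_ofNat,
    Params.eval_deltaY, hGa]
  refine and_congr ?_ (and_congr ?_ (and_congr ?_ ?_)) <;>
    exact ⟨fun h => by linear_combination h, fun h => by linear_combination h⟩

/-- The spectral coefficients are the coordinates of the transfer matrix. -/
lemma isSpectral_iff [(P.offLatticeAtInfinity t).NeBot] (hq0 : P.q ≠ 0) (hq1 : ‖P.q‖ < 1)
    (hb6 : P.b6 ≠ 0) (ht : t ≠ 0) (hGa : G.a = Params.recA a₀ p n)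
    (hG : G.Represents (P.Y t a b a₀ p n)) (S : SpectralCoeffs) :
    P.IsSpectral t a b a₀ p n S ↔
      G.transfer 0 0 = 2 * S.Wn - P.W t + P.deltaY * (S.Om + P.V t) ∧
      G.transfer 0 1 = -(P.deltaY * (C G.a * S.Th)) ∧
      G.transfer 1 0 = P.deltaY * (C G.a * S.ThPrev) ∧
      G.transfer 1 1 = 2 * S.Wn - P.W t - P.deltaY * (S.Om + P.V t) := by
  have hWp := Params.Wplus_eq (P := P) hq1 t
  have hWm := Params.Wminus_eq (P := P) hq1 t
  have h4 : (4 * C (1 / 4) : ℂ[X]) = 1 := by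
    rw [show (4 : ℂ[X]) = C 4 from (map_ofNat C 4).symm, ← C_mul]
    norm_num
  -- The normalization of the spectral coefficients, cleared of fractions.
  have hquad : S.Wn * (S.Wn - P.W t) = -(C (1 / 4) * P.deltaY ^ 2 *
      (S.Om * (-S.Om - 2 * P.V t) + C (Params.recA a₀ p n ^ 2) * S.Th * S.ThPrev)) ↔
      4 * S.Wn * (S.Wn - P.W t) = -(P.deltaY ^ 2 * (S.Om * (-S.Om - 2 * P.V t) +
        (C G.a * S.Th) * (C G.a * S.ThPrev))) := by
    rw [hGa, C_pow]
    constructor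
    · intro h
      linear_combination 4 * h - P.deltaY ^ 2 * (S.Om * (-S.Om - 2 * P.V t) +
        C (Params.recA a₀ p n) ^ 2 * S.Th * S.ThPrev) * h4
    · intro h
      linear_combination C (1 / 4) * h - S.Wn * (S.Wn - P.W t) * h4
  have hpt := fun x hx => isSpectral_at_iff hq0 hq1 hb6 ht hGa hG S (x := x) hx
  constructor
  · rintro ⟨hWn, hdd, hq⟩
    have hpoly : ∀ A B : ℂ[X], (∀ x, P.OffLattice t x → A.eval x = B.eval x) → A = B :=
      fun A B h => eq_of_eventually_eval_eq (P.offLatticeAtInfinity_le t)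
        ((P.eventually_offLattice t).mono h)
    have e₁₁ := hpoly _ _ fun x hx => ((hpt x hx).mp (hdd x hx)).1
    have e₁₂ := hpoly _ _ fun x hx => ((hpt x hx).mp (hdd x hx)).2.1
    have e₂₁ := hpoly _ _ fun x hx => ((hpt x hx).mp (hdd x hx)).2.2.1
    have e₂₂ := hpoly _ _ fun x hx => ((hpt x hx).mp (hdd x hx)).2.2.2
    have hne := mul_ne_zero (mul_ne_zero (left_ne_zero_of_mul_eq_one h4) hWn)
      (Params.Wplus_ne_zero hb6 ht)
    rw [hWp] at e₁₁ e₁₂ e₂₁ e₂₂ hne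
    exact transfer_of_cayley hne (hquad.mp hq) e₁₁ e₁₂ e₂₁ e₂₂
  · rintro ⟨k₁₁, k₁₂, k₂₁, k₂₂⟩
    have hdet := G.det_transfer
    rw [Matrix.det_fin_two, k₁₁, k₁₂, k₂₁, k₂₂, hWp, hWm] at hdet
    have hq : 4 * S.Wn * (S.Wn - P.W t) = -(P.deltaY ^ 2 * (S.Om * (-S.Om - 2 * P.V t) +
        (C G.a * S.Th) * (C G.a * S.ThPrev))) := by
      linear_combination hdet
    refine ⟨?_, fun x hx => (hpt x hx).mpr ?_, hquad.mpr hq⟩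
    · intro h
      obtain ⟨h1, -, -, h2⟩ := G.eval_zero_transfer
      have hW0 : (P.W t).eval 0 = P.b6 * t := by
        simp [Params.W, Params.eval_Wplus, Params.eval_Wminus]
        ring
      rw [k₁₁, h] at h1
      simp only [mul_zero, zero_sub, eval_add, eval_neg, hW0, eval_mul, Params.eval_deltaY,
        sub_self, zero_mul, add_zero] at h1
      exact mul_ne_zero hb6 ht (self_eq_neg.mp h1.symm)
    · rw [k₁₁, k₁₂, k₂₁, k₂₂, hWp]
      refine ⟨congrArg _ ?_, congrArg _ ?_, congrArg _ ?_, congrArg _ ?_⟩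
      · linear_combination hq
      · ring
      · ring
      · linear_combination hq

/-- Existence and uniqueness of the spectral coefficients. -/
lemma existsUnique_isSpectral [(P.offLatticeAtInfinity t).NeBot] (hq0 : P.q ≠ 0)
    (hq1 : ‖P.q‖ < 1) (hb6 : P.b6 ≠ 0) (ht : t ≠ 0) (hGa : G.a = Params.recA a₀ p n)
    (hG : G.Represents (P.Y t a b a₀ p n)) : ∃! S, P.IsSpectral t a b a₀ p n S := by
  have hδ := Params.deltaY_ne_zero (P := P) hq1
  have hq : P.q - 1 ≠ 0 := by
    refine sub_ne_zero.mpr ?_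
    rintro h
    simp [h] at hq1
  have hCa : C G.a ≠ 0 := C_ne_zero.mpr G.a_ne
  simp only [isSpectral_iff hq0 hq1 hb6 ht hGa hG]
  obtain ⟨z₁₁, z₁₂, z₂₁, z₂₂⟩ := G.eval_zero_transfer
  have hdiv : ∀ Q : ℂ[X], Q.eval 0 = 0 → P.deltaY * (C (P.q - 1)⁻¹ * Q.divX) = Q := by
    intro Q hQ
    have h := divX_mul_X_add Q
    rw [coeff_zero_eq_eval_zero, hQ, C_0, add_zero] at h
    have hc : (C (P.q - 1) * C (P.q - 1)⁻¹ : ℂ[X]) = 1 := by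
      rw [← C_mul, mul_inv_cancel₀ hq, C_1]
    conv_rhs => rw [← h]
    rw [Params.deltaY]
    linear_combination X * Q.divX * hc
  have h2 : (2 * C (1 / 2) : ℂ[X]) = 1 := by
    rw [show (2 : ℂ[X]) = C 2 from (map_ofNat C 2).symm, ← C_mul]
    norm_num
  have ha : (C G.a * C G.a⁻¹ : ℂ[X]) = 1 := by rw [← C_mul, mul_inv_cancel₀ G.a_ne, C_1]
  have d₁ := hdiv (G.transfer 0 0 - G.transfer 1 1) (by rw [eval_sub, z₁₁, z₂₂, sub_self])
  have d₂ := hdiv _ z₁₂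
  have d₃ := hdiv _ z₂₁
  refine ⟨⟨C (1 / 2) ^ 2 * (G.transfer 0 0 + G.transfer 1 1 + 2 * P.W t),
    C (1 / 2) * (C (P.q - 1)⁻¹ * (G.transfer 0 0 - G.transfer 1 1).divX) - P.V t,
    -(C G.a⁻¹ * (C (P.q - 1)⁻¹ * (G.transfer 0 1).divX)),
    C G.a⁻¹ * (C (P.q - 1)⁻¹ * (G.transfer 1 0).divX)⟩, ⟨?_, ?_, ?_, ?_⟩, ?_⟩
  · linear_combination -C (1 / 2) * d₁ - (G.transfer 0 0 + P.W t +
      C (1 / 2) * (G.transfer 0 0 + G.transfer 1 1 + 2 * P.W t)) * h2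
  · linear_combination -C G.a * C G.a⁻¹ * d₂ - G.transfer 0 1 * ha
  · linear_combination -C G.a * C G.a⁻¹ * d₃ - G.transfer 1 0 * ha
  · linear_combination C (1 / 2) * d₁ - (G.transfer 1 1 + P.W t +
      C (1 / 2) * (G.transfer 0 0 + G.transfer 1 1 + 2 * P.W t)) * h2
  · rintro ⟨Wn, Om, Th, ThPrev⟩ ⟨k₁₁, k₁₂, k₂₁, k₂₂⟩
    dsimp only at k₁₁ k₁₂ k₂₁ k₂₂
    rw [SpectralCoeffs.mk.injEq]
    refine ⟨?_, mul_left_cancel₀ hδ ?_, mul_left_cancel₀ hδ ?_, mul_left_cancel₀ hδ ?_⟩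
    · linear_combination -C (1 / 2) ^ 2 * (k₁₁ + k₂₂) - (2 * C (1 / 2) + 1) * Wn * h2
    · linear_combination -C (1 / 2) * d₁ - C (1 / 2) * (k₁₁ - k₂₂) -
        P.deltaY * (Om + P.V t) * h2
    · linear_combination C G.a⁻¹ * d₂ + C G.a⁻¹ * k₁₂ - P.deltaY * Th * ha
    · linear_combination -C G.a⁻¹ * d₃ - C G.a⁻¹ * k₂₁ - P.deltaY * ThPrev * ha

end Gauge

namespace Gauge

variable {P : Params} {t : ℂ} {n : ℕ} {F F' : ℂ → ℂ}

/-! ### The zero of `Θ_n` -/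

lemma b2_mul_b3_mul_inv (hq0 : P.q ≠ 0) (hb : P.b1 * P.b2 * P.b3 * P.b4 = 1)
    (hb6 : P.b6 ≠ 0) : P.b2 * P.b3 * (P.q ^ n)⁻¹ = P.b6 / P.b5 n := by
  have h1 : P.b1 ≠ 0 := by rintro h; simp [h] at hb
  have h4 : P.b4 ≠ 0 := by rintro h; simp [h] at hb
  have hqn := pow_ne_zero n hq0
  rw [Params.b5]
  field_simp
  linear_combination hb

/-- The leading coefficients of the two terms of `K₀₁` cancel only if `q b₅² = 1`. -/
lemma coeff_transfer_zero_one_ne_zero [(P.offLatticeAtInfinity t).NeBot] (G : Gauge P t n F)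
    (hq0 : P.q ≠ 0) (hb : P.b1 * P.b2 * P.b3 * P.b4 = 1) (hb6 : P.b6 ≠ 0)
    (hb5 : P.q * P.b5 n ^ 2 ≠ 1) : (G.transfer 0 1).coeff 2 ≠ 0 := by
  have h1 : P.b1 ≠ 0 := by rintro h; simp [h] at hb
  have h4 : P.b4 ≠ 0 := by rintro h; simp [h] at hb
  have hb50 : P.b5 n ≠ 0 := by simp [Params.b5, *]
  rw [(G.natDegree_transfer_zero_one hq0).2]
  refine mul_ne_zero G.a_ne fun h0 => hb5 ?_
  have e1 := b2_mul_b3_mul_inv (n := n) hq0 hb hb6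
  have e2 : P.b2 * P.b3 * (P.q ^ (n + 1))⁻¹ = P.b2 * P.b3 * (P.q ^ n)⁻¹ * P.q⁻¹ := by
    rw [pow_succ, mul_inv]
    ring
  have e3 : P.q ^ n * P.b1 * P.b4 * P.b6 ^ 2 = P.b5 n * P.b6 := by
    rw [Params.b5]
    ring
  rw [e2, e1, e3] at h0
  field_simp at h0
  refine mul_left_cancel₀ hb6 ?_
  linear_combination h0

/-- `Θ_n` is a polynomial of exact degree one. -/
lemma natDegree_Th [(P.offLatticeAtInfinity t).NeBot] (G : Gauge P t n F) (hq0 : P.q ≠ 0)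
    (hb : P.b1 * P.b2 * P.b3 * P.b4 = 1) (hb6 : P.b6 ≠ 0) (hb5 : P.q * P.b5 n ^ 2 ≠ 1)
    {Th : ℂ[X]} (h : G.transfer 0 1 = -(P.deltaY * (C G.a * Th))) :
    Th.natDegree ≤ 1 ∧ Th.coeff 1 ≠ 0 := by
  have hd := (G.natDegree_transfer_zero_one hq0).1
  have e : G.transfer 0 1 = C (-((P.q - 1) * G.a)) * (X * Th) := by
    rw [h, Params.deltaY, C_neg, C_mul]
    ring
  have hcoeff : ∀ m, (G.transfer 0 1).coeff (m + 1) = -((P.q - 1) * G.a) * Th.coeff m := by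
    intro m
    rw [e, coeff_C_mul, coeff_X_mul]
  have hlead := G.coeff_transfer_zero_one_ne_zero hq0 hb hb6 hb5
  rw [hcoeff 1] at hlead
  obtain ⟨hκ, h1⟩ := mul_ne_zero_iff.mp hlead
  refine ⟨natDegree_le_iff_coeff_eq_zero.mpr fun m hm => ?_, h1⟩
  have := hcoeff m
  rw [coeff_eq_zero_of_natDegree_lt (by omega)] at this
  exact (mul_eq_zero.mp this.symm).resolve_left hκ

end Gauge

lemma existsUnique_isRoot_of_natDegree_le_one {Q : ℂ[X]} (hd : Q.natDegree ≤ 1)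
    (h : Q.coeff 1 ≠ 0) : ∃! x, Q.IsRoot x := by
  have e := eq_X_add_C_of_natDegree_le_one hd
  have he : ∀ x, Q.eval x = Q.coeff 1 * x + Q.coeff 0 := fun x => by
    conv_lhs => rw [e]
    simp
  refine ⟨-Q.coeff 0 / Q.coeff 1, ?_, fun y hy => ?_⟩
  · change Q.eval _ = 0
    rw [he]
    field_simp
    ring
  · replace hy : Q.eval y = 0 := hy
    rw [he] at hy
    rw [eq_div_iff h]
    linear_combination hy

namespace Gauge

/-! ### The transfer matrix in the time direction -/

variable {P : Params} {t : ℂ} {n : ℕ} {F F' : ℂ → ℂ}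

/-- The numerator `b₆ q t - x` of the ratio of the weights at the times `q t` and `t`. -/
noncomputable def ratioNum (P : Params) (t : ℂ) : ℂ[X] := C (P.b6 * P.q * t) - X

/-- The denominator `b₆ (q t - b₆ x)` of the ratio of the weights at the times `q t` and `t`. -/
noncomputable def ratioDen (P : Params) (t : ℂ) : ℂ[X] :=
  C (P.b6 * P.q * t) - C (P.b6 ^ 2) * X

/-- The part `(b₆ t - x) (t - b₆ x)` of `W² - Δy² V²` that depends on the time. -/
noncomputable def movingPart (P : Params) (t : ℂ) : ℂ[X] :=
  C P.b6 * X ^ 2 + C (-((1 + P.b6 ^ 2) * t)) * X + C (P.b6 * t ^ 2)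

lemma eval_ratioNum (P : Params) (t x : ℂ) : (ratioNum P t).eval x = P.b6 * P.q * t - x := by
  simp [ratioNum]

lemma eval_ratioDen (P : Params) (t x : ℂ) :
    (ratioDen P t).eval x = P.b6 * (P.q * t - P.b6 * x) := by
  simp [ratioDen]
  ring

lemma eval_movingPart (P : Params) (t x : ℂ) :
    (movingPart P t).eval x = (P.b6 * t - x) * (t - P.b6 * x) := by
  simp [movingPart]
  ring

/-- The polynomial matrix `J` with `(b₆ q t - x) Y(x; q t) = J(x) Y(x; t)`, where `c` is the
constant in the evolution of the Stieltjes transform. -/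
noncomputable def step (G : Gauge P t n F) (G' : Gauge P (P.q * t) n F') (c : ℂ) :
    Matrix (Fin 2) (Fin 2) ℂ[X] :=
  G'.mat * !![ratioNum P t, C c; 0, ratioDen P t] * G.matInv

variable (G : Gauge P t n F) (G' : Gauge P (P.q * t) n F') (c : ℂ)

lemma step_eq : G.step G' c =
    !![C G.a * ((G'.r * ratioDen P t - G'.p * C c) * G.p' - G'.p * ratioNum P t * G.r'),
      C G.a * (G'.p * ratioNum P t * G.r - (G'.r * ratioDen P t - G'.p * C c) * G.p);
      C G.a * ((G'.r' * ratioDen P t - G'.p' * C c) * G.p' - G'.p' * ratioNum P t * G.r'),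
      C G.a * (G'.p' * ratioNum P t * G.r - (G'.r' * ratioDen P t - G'.p' * C c) * G.p)] := by
  rw [step, mat, matInv]
  refine Matrix.ext fun i j => ?_
  fin_cases i <;> fin_cases j <;> simp [Matrix.mul_apply, Fin.sum_univ_two] <;> ring

lemma det_step [(P.offLatticeAtInfinity t).NeBot] [(P.offLatticeAtInfinity (P.q * t)).NeBot] :
    (G.step G' c).det = C (G.a / G'.a) * (ratioNum P t * ratioDen P t) := by
  rw [step, Matrix.det_mul, Matrix.det_mul, det_mat, det_matInv, Matrix.det_fin_two_of,
    div_eq_mul_inv, C_mul]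
  ring

lemma tendsto_ratioNum (P : Params) (t : ℂ) {l : Filter ℂ} (hl : l ≤ cobounded ℂ) :
    Tendsto (fun x => (ratioNum P t).eval x / x ^ 1) l (𝓝 (-1)) := by
  have hd : (ratioNum P t).natDegree ≤ 1 := by
    rw [show ratioNum P t = C (-1) * X + C (P.b6 * P.q * t) by simp [ratioNum]; ring]
    exact natDegree_linear_le
  have hc : (ratioNum P t).coeff 1 = -1 := by simp [ratioNum]
  simpa only [hc] using tendsto_eval_div_pow hl hd

lemma tendsto_ratioDen (P : Params) (t : ℂ) {l : Filter ℂ} (hl : l ≤ cobounded ℂ) :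
    Tendsto (fun x => (ratioDen P t).eval x / x ^ 1) l (𝓝 (-P.b6 ^ 2)) := by
  have hd : (ratioDen P t).natDegree ≤ 1 := by
    rw [show ratioDen P t = C (-P.b6 ^ 2) * X + C (P.b6 * P.q * t) by simp [ratioDen]; ring]
    exact natDegree_linear_le
  have hc : (ratioDen P t).coeff 1 = -P.b6 ^ 2 := by
    simp only [ratioDen, coeff_sub, coeff_C, coeff_C_mul, coeff_X_one]
    simp
  simpa only [hc] using tendsto_eval_div_pow hl hd

section

variable [(P.offLatticeAtInfinity t).NeBot] (hq0 : P.q ≠ 0)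
  (hF : ∀ x, P.OffLattice t x →
    P.b6 * (P.q * t - P.b6 * x) * F' x = (P.b6 * P.q * t - x) * F x + c)
include hq0 hF

lemma natDegree_step_zero_zero : (G.step G' c 0 0).natDegree ≤ 1 ∧
    (G.step G' c 0 0).coeff 1 = -(G'.γ / G.γ) := by
  have hle := Params.offLatticeAtInfinity_le_shift hq0 t
  have hl := P.offLatticeAtInfinity_le t
  refine natDegree_le_of_tendsto hl ?_
  have h1 := ((tendsto_ratioNum P t hl).mul (G'.tendsto_p.mono_left hle)).mul
    G.tendsto_second'
  have h2 := (((tendsto_ratioDen P t hl).mul (G'.tendsto_second.mono_left hle)).mul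
    G.tendsto_p').mul (tendsto_inv₀_cobounded.mono_left hl)
  have h := (h1.sub h2).const_mul G.a
  have e : G.a * (-1 * G'.γ * (G.a * G.γ)⁻¹ - -P.b6 ^ 2 * G'.γ⁻¹ * 0 * 0) = -(G'.γ / G.γ) := by
    have := G.γ_ne
    have := G'.γ_ne
    have := G.a_ne
    field_simp
    ring
  rw [e] at h
  refine h.congr' ?_
  filter_upwards [Params.eventually_offLattice P t] with x hx
  have hx0 := hx.1
  have hc := hF x hx
  rw [← eval_ratioDen, ← eval_ratioNum] at hc
  rw [step_eq]
  simp only [Matrix.cons_val', Matrix.cons_val_zero, Matrix.of_apply, Matrix.cons_val_fin_one,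
    eval_mul, eval_sub, eval_C]
  field_simp
  linear_combination -(G.a * x * x ^ n * G'.p.eval x * G.p'.eval x) * hc

/-- The entry `J₀₁` is constant; this is what makes the elimination possible. -/
lemma natDegree_step_zero_one : (G.step G' c 0 1).natDegree ≤ 0 := by
  have hle := Params.offLatticeAtInfinity_le_shift hq0 t
  have hl := P.offLatticeAtInfinity_le t
  have h1 := ((tendsto_ratioNum P t hl).mul (G'.tendsto_p.mono_left hle)).mul
    G.tendsto_second
  have h2 := ((tendsto_ratioDen P t hl).mul (G'.tendsto_second.mono_left hle)).mul
    G.tendsto_p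
  have h := (h2.sub h1).const_mul G.a
  refine (natDegree_le_of_tendsto hl (h.congr' ?_)).1
  filter_upwards [Params.eventually_offLattice P t] with x hx
  have hx0 := hx.1
  have hc := hF x hx
  rw [← eval_ratioDen, ← eval_ratioNum] at hc
  rw [step_eq]
  simp only [Matrix.cons_val', Matrix.cons_val_zero, Matrix.cons_val_one, Matrix.of_apply,
    Matrix.cons_val_fin_one, eval_mul, eval_sub, eval_C]
  field_simp
  linear_combination G.a * x * x ^ n * G'.p.eval x * G.p.eval x * hc

lemma natDegree_step_one_one : (G.step G' c 1 1).natDegree ≤ 1 ∧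
    (G.step G' c 1 1).coeff 1 = -(P.b6 ^ 2 * (G.a * G.γ / (G'.a * G'.γ))) := by
  have hle := Params.offLatticeAtInfinity_le_shift hq0 t
  have hl := P.offLatticeAtInfinity_le t
  refine natDegree_le_of_tendsto hl ?_
  have h1 := (((tendsto_ratioNum P t hl).mul (G'.tendsto_p'.mono_left hle)).mul
    G.tendsto_second).mul (tendsto_inv₀_cobounded.mono_left hl)
  have h2 := ((tendsto_ratioDen P t hl).mul (G'.tendsto_second'.mono_left hle)).mul
    G.tendsto_p
  have h := (h2.sub h1).const_mul G.a
  have e : G.a * (-P.b6 ^ 2 * (G'.a * G'.γ)⁻¹ * G.γ - -1 * 0 * G.γ⁻¹ * 0) =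
      -(P.b6 ^ 2 * (G.a * G.γ / (G'.a * G'.γ))) := by
    have := G.γ_ne
    have := G'.γ_ne
    have := G'.a_ne
    field_simp
    ring
  rw [e] at h
  refine h.congr' ?_
  filter_upwards [Params.eventually_offLattice P t] with x hx
  have hx0 := hx.1
  have hc := hF x hx
  rw [← eval_ratioDen, ← eval_ratioNum] at hc
  rw [step_eq]
  simp only [Matrix.cons_val', Matrix.cons_val_one, Matrix.of_apply,
    Matrix.cons_val_fin_one, eval_mul, eval_sub, eval_C]
  field_simp
  linear_combination G.a * x * x ^ n * G'.p'.eval x * G.p.eval x * hc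

/-- Compatibility of the shifts in space and in time. -/
lemma step_compat [(P.offLatticeAtInfinity (P.q * t)).NeBot] :
    movingPart P (P.q * t) • ((dilate P.q).mapMatrix (G.step G' c) * G.transfer) =
      (C P.q * movingPart P t) • (G'.transfer * G.step G' c) := by
  have hl := P.offLatticeAtInfinity_le t
  have e1 : (dilate P.q).mapMatrix (G.step G' c) * G.transfer =
      (dilate P.q).mapMatrix G'.mat *
      ((dilate P.q).mapMatrix !![ratioNum P t, C c; 0, ratioDen P t] *
        !![P.Wplus t, G.U; 0, P.Wminus t]) * G.matInv := by
    have h : (dilate P.q).mapMatrix G.matInv * (dilate P.q).mapMatrix G.mat = 1 := by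
      rw [← map_mul, G.matInv_mul_mat, map_one]
    rw [step, transfer, map_mul, map_mul]
    simp only [Matrix.mul_assoc]
    rw [← Matrix.mul_assoc ((dilate P.q).mapMatrix G.matInv), h, Matrix.one_mul]
  have e2 : G'.transfer * G.step G' c = (dilate P.q).mapMatrix G'.mat *
      (!![P.Wplus (P.q * t), G'.U; 0, P.Wminus (P.q * t)] *
        !![ratioNum P t, C c; 0, ratioDen P t]) * G.matInv := by
    rw [step, transfer]
    simp only [Matrix.mul_assoc]
    rw [← Matrix.mul_assoc G'.matInv, G'.matInv_mul_mat, Matrix.one_mul]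
  suffices key : movingPart P (P.q * t) •
      ((dilate P.q).mapMatrix !![ratioNum P t, C c; 0, ratioDen P t] *
        !![P.Wplus t, G.U; 0, P.Wminus t]) = (C P.q * movingPart P t) •
      (!![P.Wplus (P.q * t), G'.U; 0, P.Wminus (P.q * t)] *
        !![ratioNum P t, C c; 0, ratioDen P t]) by
    have h := congrArg (fun Z => (dilate P.q).mapMatrix G'.mat * Z * G.matInv) key
    simpa only [e1, e2, Matrix.mul_smul, Matrix.smul_mul] using h
  refine Matrix.ext fun i j => eq_of_eventually_eval_eq hl ?_
  filter_upwards [Params.eventually_offLattice P t] with x hx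
  have hx' : P.OffLattice t (P.q * x) := by simpa using hx.zpow_mul hq0 1
  have h1 := hF x hx
  have h2 := hF _ hx'
  have h3 := G.pearson x hx
  have h4 := G'.pearson x (hx.shift hq0)
  simp only [Params.eval_Wplus, Params.eval_Wminus] at h3 h4
  fin_cases i <;> fin_cases j <;>
    simp [Matrix.mul_apply, Fin.sum_univ_two, eval_ratioNum, eval_ratioDen, eval_movingPart,
      Params.eval_Wplus, Params.eval_Wminus, -mul_eq_mul_left_iff, -mul_eq_mul_right_iff]
  · ring
  · generalize F (P.q * x) = Fq at h2 h3
    generalize F' (P.q * x) = Fq' at h2 h4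
    linear_combination -(P.b6 * (P.q * t) - x) * (P.q * t - P.b6 * x) *
      ((1 - P.b2 * x) * (1 - P.b3 * x) * (P.b6 * t - x)) * h2 -
      (P.b6 * (P.q * t) - x) * (P.q * t - P.b6 * x) * (P.b6 * P.q * t - P.q * x) * h3 +
      P.q * ((P.b6 * t - x) * (t - P.b6 * x)) * (P.b6 * (P.q * t - P.b6 * x)) * h4 +
      P.q * ((P.b6 * t - x) * (t - P.b6 * x)) *
        (P.b6 * (1 - P.b1 * x) * (1 - P.b4 * x) * (P.q * t - P.b6 * x)) * h1
  · ring

end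

end Gauge

/-! ### The relation between consecutive zeros -/

lemma eval_of_natDegree_le_one {Q : ℂ[X]} (hd : Q.natDegree ≤ 1) (x : ℂ) :
    Q.eval x = Q.coeff 1 * x + Q.coeff 0 := by
  conv_lhs => rw [eq_X_add_C_of_natDegree_le_one hd]
  simp

/-- A polynomial of degree at most two with zeros `0` and `g ≠ 0`. -/
lemma eval_of_natDegree_le_two {Q : ℂ[X]} (hd : Q.natDegree ≤ 2) (h0 : Q.eval 0 = 0) {g : ℂ}
    (hg0 : g ≠ 0) (hg : Q.eval g = 0) (x : ℂ) : Q.eval x = Q.coeff 2 * x * (x - g) := by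
  have e : ∀ x, Q.eval x = Q.coeff 0 + Q.coeff 1 * x + Q.coeff 2 * x ^ 2 := fun x => by
    rw [eval_eq_sum_range' (Nat.lt_succ_of_le hd)]
    simp [Finset.sum_range_succ]
  rw [e] at h0 hg
  rw [e]
  have h1 : Q.coeff 1 + Q.coeff 2 * g = 0 := by
    refine mul_left_cancel₀ hg0 ?_
    linear_combination hg - h0
  linear_combination h0 + x * h1

namespace Gauge

variable {P : Params} {t : ℂ} {n : ℕ} {F F' : ℂ → ℂ}

lemma coeff_movingPart : (movingPart P t).coeff 2 = P.b6 := by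
  simp only [movingPart, coeff_add, coeff_C_mul, coeff_X_pow, coeff_X, coeff_C]
  norm_num

lemma natDegree_movingPart (hb6 : P.b6 ≠ 0) : (movingPart P t).natDegree = 2 :=
  natDegree_quadratic hb6

/-- The zeros `b₆ t`, `t / b₆` at the time `t` and `b₆ q t`, `q t / b₆` at the time `q t` are
distinct by regularity. -/
lemma isCoprime_movingPart (hq0 : P.q ≠ 0) (hq1 : ‖P.q‖ < 1) (hb6 : P.b6 ≠ 0) (ht : t ≠ 0)
    (hreg : P.Regular t) : IsCoprime (movingPart P t) (movingPart P (P.q * t)) := by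
  have hsep := fun k : ℤ => hreg.ne (Params.eval_Wplus_root hb6 t) (P.eval_Wminus_root t) k
  have hq : P.q ≠ 1 := by rintro h; simp [h] at hq1
  rw [isCoprime_iff_aeval_ne_zero_of_isAlgClosed ℂ ℂ]
  intro x
  simp only [coe_aeval_eq_eval, eval_movingPart]
  by_contra! h
  obtain ⟨h1, h2⟩ := h
  rcases mul_eq_zero.mp h1 with h1 | h1 <;> rcases mul_eq_zero.mp h2 with h2 | h2
  · refine hq (mul_left_cancel₀ (mul_ne_zero hb6 ht) ?_)
    linear_combination h2 - h1
  · refine hsep 1 ?_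
    rw [zpow_one]
    field_simp
    refine mul_left_cancel₀ ht ?_
    linear_combination P.b6 * h1 - h2
  · refine hsep (-1) ?_
    rw [zpow_neg_one]
    field_simp
    refine mul_left_cancel₀ ht ?_
    linear_combination P.b6 * h2 - h1
  · refine hq (mul_left_cancel₀ ht ?_)
    linear_combination h2 - h1

end Gauge

/-- Elimination of the matrices `K`, `L`, `J` from the compatibility relation
`β' J(q x) K = q β L J`: the entries in the first row have a common factor, and at the zero `1 / f`
of the cofactor the off-diagonal entries `K₀₁` and `L₀₁` are related to `det K`. -/
lemma elimination {q t b6 j s s' κ κ' f g g' : ℂ} {β β' Q Jq : ℂ[X]}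
    {K L J : Matrix (Fin 2) (Fin 2) ℂ[X]} (hb6 : b6 ≠ 0) (ht : t ≠ 0)
    (hβ0 : β.eval 0 = b6 * t ^ 2) (hβd : β.natDegree = 2) (hβc : β.coeff 2 = b6)
    (hβ'd : β'.natDegree = 2) (hβ'c : β'.coeff 2 = b6)
    (hco : IsCoprime β β')
    (hJqd : Jq.natDegree ≤ 1) (hJq : Jq.coeff 1 = -(s * q))
    (hJ11d : (J 1 1).natDegree ≤ 1) (hJ11 : (J 1 1).coeff 1 = -(b6 ^ 2 * s'))
    (hdetJ : J 0 0 * J 1 1 - C j * J 1 0 = C (b6 * (s * s')) * β')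
    (h00 : β' * (Jq * K 0 0 + C j * K 1 0) = C q * β * (L 0 0 * J 0 0 + L 0 1 * J 1 0))
    (h01 : β' * (Jq * K 0 1 + C j * K 1 1) = C q * β * (L 0 0 * C j + L 0 1 * J 1 1))
    (hdetK : K 0 0 * K 1 1 - K 0 1 * K 1 0 = C b6 * β * Q)
    (hK01d : (K 0 1).natDegree ≤ 2) (hK01 : (K 0 1).eval 0 = 0)
    (hK11d : (K 1 1).natDegree ≤ 3) (hK11c : (K 1 1).coeff 3 = κ)
    (hK11 : (K 1 1).eval 0 = b6 * t)
    (hL01d : (L 0 1).natDegree ≤ 2) (hL01 : (L 0 1).eval 0 = 0)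
    (hL00c : (L 0 0).coeff 3 = κ')
    (hg0 : g ≠ 0) (hg : (K 0 1).eval g = 0) (hg'0 : g' ≠ 0) (hg' : (L 0 1).eval g' = 0)
    (hβg' : β'.eval g' ≠ 0) (hf0 : f ≠ 0)
    (hf : q * t * (L 0 0).eval g' = -(β'.eval g' * (f * g' - 1))) :
    b6 * j * f = t * (s * q * (K 0 1).coeff 2 - j * κ) ∧
    b6 * j * f = -(q * t * (j * κ' - (L 0 1).coeff 2 * (b6 ^ 2 * s'))) ∧
    j ^ 2 * (f ^ 4 * Q.eval f⁻¹) =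
      q * (s * s') * (K 0 1).coeff 2 * (L 0 1).coeff 2 * ((f * g - 1) * (f * g' - 1)) := by
  have hβne : β ≠ 0 := by rintro rfl; simp at hβd
  have hβ'ne : β' ≠ 0 := by rintro rfl; simp at hβ'd
  obtain ⟨R, hR⟩ : β ∣ Jq * K 0 0 + C j * K 1 0 := hco.dvd_of_dvd_mul_left
    ⟨C q * (L 0 0 * J 0 0 + L 0 1 * J 1 0), by rw [h00]; ring⟩
  obtain ⟨ℓ, hℓ⟩ : β ∣ Jq * K 0 1 + C j * K 1 1 := hco.dvd_of_dvd_mul_left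
    ⟨C q * (L 0 0 * C j + L 0 1 * J 1 1), by rw [h01]; ring⟩
  have hR' : β' * R = C q * (L 0 0 * J 0 0 + L 0 1 * J 1 0) := by
    refine mul_left_cancel₀ hβne ?_
    linear_combination h00 - β' * hR
  have hℓ' : β' * ℓ = C q * (L 0 0 * C j + L 0 1 * J 1 1) := by
    refine mul_left_cancel₀ hβne ?_
    linear_combination h01 - β' * hℓ
  -- The cofactor `ℓ` of the entry `(0, 1)` is linear.
  have hE : (Jq * K 0 1 + C j * K 1 1).natDegree ≤ 3 :=
    natDegree_add_le_of_le (natDegree_mul_le_of_le hJqd hK01d)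
      ((natDegree_C_mul_le _ _).trans hK11d)
  have hℓd : ℓ.natDegree ≤ 1 := by
    rcases eq_or_ne ℓ 0 with rfl | h
    · simp
    · rw [hℓ, natDegree_mul hβne h, hβd] at hE
      omega
  have hc1 : b6 * ℓ.coeff 1 = -(s * q) * (K 0 1).coeff 2 + j * κ := by
    have h := congrArg (fun A : ℂ[X] => A.coeff 3) hℓ
    simp only [coeff_add, coeff_C_mul] at h
    rw [show (3 : ℕ) = 1 + 2 from rfl, coeff_mul_add_eq_of_natDegree_le hJqd hK01d,
      show (1 + 2 : ℕ) = 2 + 1 from rfl, coeff_mul_add_eq_of_natDegree_le hβd.le hℓd, hJq, hβc] at h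
    rw [← h, ← hK11c]
  have hc2 : b6 * ℓ.coeff 1 = q * (κ' * j + (L 0 1).coeff 2 * -(b6 ^ 2 * s')) := by
    have h := congrArg (fun A : ℂ[X] => A.coeff 3) hℓ'
    simp only [coeff_add, coeff_C_mul, coeff_mul_C] at h
    rw [show (3 : ℕ) = 2 + 1 from rfl, coeff_mul_add_eq_of_natDegree_le hβ'd.le hℓd,
      coeff_mul_add_eq_of_natDegree_le hL01d hJ11d, hJ11, hβ'c] at h
    rw [h, ← hL00c]
  -- Its values at `0` and at `g'` identify it as `-(j / t) (f x - 1)`.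
  have hℓx := eval_of_natDegree_le_one hℓd
  have hz : j = t * ℓ.coeff 0 := by
    have h := congrArg (Polynomial.eval 0) hℓ
    simp only [eval_add, eval_mul, eval_C, hK01, hK11, hβ0, hℓx] at h
    refine mul_left_cancel₀ (mul_ne_zero hb6 ht) ?_
    linear_combination h
  have hf1 : t * ℓ.coeff 1 = -(j * f) := by
    have h := congrArg (Polynomial.eval g') hℓ'
    simp only [eval_add, eval_mul, eval_C, hg', hℓx] at h
    refine mul_left_cancel₀ hβg' (mul_left_cancel₀ hg'0 ?_)
    linear_combination t * h + j * hf + β'.eval g' * hz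
  have hℓf : ℓ.eval f⁻¹ = 0 := by
    rw [hℓx]
    field_simp
    refine mul_left_cancel₀ ht ?_
    linear_combination hf1 - f * hz
  -- Determinants of the first rows, divided by `β` and by `β'`.
  have hI : C j * (C b6 * Q) = -(R * K 0 1) + ℓ * K 0 0 := by
    refine mul_left_cancel₀ hβne ?_
    linear_combination -C j * hdetK - K 0 1 * hR + K 0 0 * hℓ
  have hII : -(C j * R) + ℓ * J 0 0 = C q * L 0 1 * C (b6 * (s * s')) := by
    refine mul_left_cancel₀ hβ'ne ?_
    linear_combination -C j * hR' + J 0 0 * hℓ' + C q * L 0 1 * hdetJ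
  have hI' := congrArg (Polynomial.eval f⁻¹) hI
  have hII' := congrArg (Polynomial.eval f⁻¹) hII
  have hK := eval_of_natDegree_le_two hK01d hK01 hg0 hg f⁻¹
  have hL := eval_of_natDegree_le_two hL01d hL01 hg'0 hg' f⁻¹
  simp only [eval_add, eval_mul, eval_neg, eval_C, hℓf, zero_mul, add_zero, hK, hL] at hI' hII'
  refine ⟨?_, ?_, ?_⟩
  · linear_combination -t * hc1 + b6 * hf1
  · linear_combination -t * hc2 + b6 * hf1
  · refine mul_left_cancel₀ hb6 ?_
    generalize Q.eval f⁻¹ = Qf at *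
    have hu : ∀ z : ℂ, f ^ 2 * (f⁻¹ * (f⁻¹ - z)) = 1 - f * z := fun z => by field_simp
    have hu₁ := hu g
    have hu₂ := hu g'
    generalize f⁻¹ = u at *
    linear_combination f ^ 4 * j * hI' + f ^ 4 * ((K 0 1).coeff 2 * u * (u - g)) * hII' +
      q * (L 0 1).coeff 2 * b6 * (s * s') * (K 0 1).coeff 2 *
        (f ^ 2 * (u * (u - g')) * hu₁ + (1 - f * g) * hu₂)

lemma natDegree_dilate_le_one (q : ℂ) {Q : ℂ[X]} (hd : Q.natDegree ≤ 1) :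
    (dilate q Q).natDegree ≤ 1 ∧ (dilate q Q).coeff 1 = Q.coeff 1 * q := by
  have e : dilate q Q = C (Q.coeff 1 * q) * X + C (Q.coeff 0) := by
    conv_lhs => rw [eq_X_add_C_of_natDegree_le_one hd]
    simp [dilate]
    ring
  rw [e]
  exact ⟨natDegree_linear_le, by simp [coeff_C]⟩

namespace Gauge

variable {P : Params} {t : ℂ} {n : ℕ} {F F' : ℂ → ℂ}

/-- The relation between the zeros `g` and `g'` of `Θ_n` at the times `t` and `q t`, where `f`
parametrizes the diagonal entry of the transfer matrix at `g'`. It is `elimination` with the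
leading coefficients expressed by `b₅`; the first two conclusions of the latter remove the
normalization constants from the third. -/
theorem zero_relation [(P.offLatticeAtInfinity t).NeBot]
    [(P.offLatticeAtInfinity (P.q * t)).NeBot] (G : Gauge P t n F)
    (G' : Gauge P (P.q * t) n F') (c : ℂ)
    (hF : ∀ x, P.OffLattice t x →
      P.b6 * (P.q * t - P.b6 * x) * F' x = (P.b6 * P.q * t - x) * F x + c)
    (hq0 : P.q ≠ 0) (hq1 : ‖P.q‖ < 1) (hb : P.b1 * P.b2 * P.b3 * P.b4 = 1) (hb6 : P.b6 ≠ 0)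
    (ht : t ≠ 0) (hreg : P.Regular t) (hb5 : P.q * P.b5 n ^ 2 ≠ 1) {f g g' : ℂ}
    (hg : (G.transfer 0 1).eval g = 0) (hg0 : g ≠ 0) (hg1 : g ≠ P.b6 * t) (hg2 : g ≠ P.b6⁻¹ * t)
    (hg' : (G'.transfer 0 1).eval g' = 0) (hg'0 : g' ≠ 0) (hg'1 : g' ≠ P.b6 * (P.q * t))
    (hg'2 : g' ≠ P.b6⁻¹ * (P.q * t)) (hf0 : f ≠ 0)
    (hf : P.q * t * (G'.transfer 0 0).eval g' =
      -((movingPart P (P.q * t)).eval g' * (f * g' - 1))) :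
    P.q * t ^ 2 * ((f - P.b1) * (f - P.b2) * (f - P.b3) * (f - P.b4)) =
      (f - P.b5 n * P.q * t) * (f - (P.b5 n)⁻¹ * t) * ((f * g' - 1) * (f * g - 1)) := by
  have h1 : P.b1 ≠ 0 := by rintro h; simp [h] at hb
  have h4 : P.b4 ≠ 0 := by rintro h; simp [h] at hb
  have hb50 : P.b5 n ≠ 0 := by simp [Params.b5, *]
  have hγ := G.γ_ne
  have hγ' := G'.γ_ne
  have ha := G.a_ne
  have ha' := G'.a_ne
  have hco := isCoprime_movingPart hq0 hq1 hb6 ht hreg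
  obtain ⟨d00, e00⟩ := natDegree_step_zero_zero G G' c hq0 hF
  have d01 := eq_C_of_natDegree_le_zero (natDegree_step_zero_one G G' c hq0 hF)
  obtain ⟨d11, e11⟩ := natDegree_step_one_one G G' c hq0 hF
  obtain ⟨dq, eq⟩ := natDegree_dilate_le_one P.q d00
  obtain ⟨-, c00, -, c11⟩ := G.eval_zero_transfer
  obtain ⟨-, c00', -, -⟩ := G'.eval_zero_transfer
  obtain ⟨dK, -⟩ := G.natDegree_transfer_zero_one hq0
  obtain ⟨dL, -⟩ := G'.natDegree_transfer_zero_one hq0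
  obtain ⟨dK', eK'⟩ := G.natDegree_transfer_one_one hq0
  have eL' := (G'.natDegree_transfer_zero_zero hq0).2
  have hdet := det_step G G' c
  have hdetK := G.det_transfer
  have hk := G.coeff_transfer_zero_one_ne_zero hq0 hb hb6 hb5
  have hcompat := step_compat G G' c hq0 hF
  generalize hj : (G.step G' c 0 1).coeff 0 = j at d01
  have h00 := congrFun (congrFun hcompat 0) 0
  have h01 := congrFun (congrFun hcompat 0) 1
  simp only [Matrix.smul_apply, Matrix.mul_apply, Fin.sum_univ_two, RingHom.mapMatrix_apply,
    Matrix.map_apply, smul_eq_mul, d01] at h00 h01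
  have hdil : dilate P.q (C j) = C j := by simp [dilate]
  rw [hdil] at h00 h01
  rw [Matrix.det_fin_two, d01] at hdet
  rw [Matrix.det_fin_two] at hdetK
  rw [e00] at eq
  have eκ := b2_mul_b3_mul_inv (n := n) hq0 hb hb6
  have hβ : ∀ x, (movingPart P t).eval x = 0 → (movingPart P (P.q * t)).eval x ≠ 0 := by
    intro x hx hx'
    obtain ⟨u, v, huv⟩ := hco
    simpa [hx, hx'] using congrArg (Polynomial.eval x) huv
  have hK := eval_of_natDegree_le_two dK c00 hg0 hg
  -- The off-diagonal entry `j` of the step matrix does not vanish: otherwise the linear diagonal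
  -- entry would have the two zeros `b₆ t` and `t / b₆`.
  have hj0 : j ≠ 0 := by
    rintro rfl
    have key : ∀ x, (movingPart P t).eval x = 0 → x ≠ 0 → x ≠ g →
        (dilate P.q (G.step G' c 0 0)).eval x = 0 := by
      intro x hx hx0 hxg
      have h := congrArg (Polynomial.eval x) h01
      simp only [eval_add, eval_mul, hx, C_0, eval_zero, mul_zero, zero_mul, add_zero, hK] at h
      simpa [hβ x hx, hk, hx0, sub_ne_zero.mpr hxg] using h
    have z1 := key (P.b6 * t) (by simp [eval_movingPart]) (mul_ne_zero hb6 ht) hg1.symm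
    have z2 := key (P.b6⁻¹ * t)
      (by rw [eval_movingPart, mul_inv_cancel_left₀ hb6, sub_self, mul_zero])
      (mul_ne_zero (inv_ne_zero hb6) ht) hg2.symm
    rw [eval_of_natDegree_le_one dq, eq] at z1 z2
    have hne := hreg.ne (Params.eval_Wplus_root hb6 t) (P.eval_Wminus_root t) 0
    refine hne (mul_left_cancel₀ (mul_ne_zero (div_ne_zero hγ' hγ) hq0) ?_)
    rw [zpow_zero, one_mul, div_eq_inv_mul]
    linear_combination z2 - z1
  obtain ⟨r1, r2, r3⟩ := elimination (q := P.q) (s := G'.γ / G.γ)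
    (s' := G.a * G.γ / (G'.a * G'.γ)) (β := movingPart P t) (β' := movingPart P (P.q * t))
    (Q := (1 - C P.b1 * X) * (1 - C P.b2 * X) * (1 - C P.b3 * X) * (1 - C P.b4 * X))
    (K := G.transfer) (L := G'.transfer) (J := G.step G' c) hb6 ht
    (by rw [eval_movingPart]; ring) (natDegree_movingPart hb6) coeff_movingPart
    (natDegree_movingPart hb6) coeff_movingPart hco dq (by rw [eq]; ring) d11 e11
    (by
      have e : P.b6 * (G'.γ / G.γ * (G.a * G.γ / (G'.a * G'.γ))) = G.a / G'.a * P.b6 := by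
        field_simp
      rw [hdet, e, C_mul, mul_assoc]
      congr 1
      refine Polynomial.funext fun x => ?_
      simp only [eval_mul, eval_ratioNum, eval_ratioDen, eval_movingPart, eval_C]
      ring)
    h00 h01
    (by
      rw [hdetK]
      refine Polynomial.funext fun x => ?_
      simp only [eval_mul, eval_movingPart, eval_C, Params.eval_Wplus, Params.eval_Wminus,
        eval_sub, eval_one, eval_X]
      ring)
    dK c00 dK' eK' c11 dL c00' eL' hg0 hg hg'0 hg'
    (by
      rw [eval_movingPart]
      refine mul_ne_zero (sub_ne_zero.mpr hg'1.symm) (sub_ne_zero.mpr fun h => hg'2 ?_)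
      rw [h, inv_mul_cancel_left₀ hb6])
    hf0 hf
  rw [eκ] at r1
  have e5 : P.q ^ n * P.b1 * P.b4 * P.b6 ^ 2 = P.b5 n * P.b6 := by
    rw [Params.b5]
    ring
  rw [e5] at r2
  have eQ : f ^ 4 * ((1 - C P.b1 * X) * (1 - C P.b2 * X) * (1 - C P.b3 * X) *
      (1 - C P.b4 * X) : ℂ[X]).eval f⁻¹ = (f - P.b1) * (f - P.b2) * (f - P.b3) * (f - P.b4) := by
    simp only [eval_mul, eval_sub, eval_one, eval_C, eval_X]
    field_simp
  rw [eQ] at r3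
  generalize G'.γ / G.γ = s at *
  generalize G.a * G.γ / (G'.a * G'.γ) = s' at *
  generalize (G.transfer 0 1).coeff 2 = k at *
  generalize (G'.transfer 0 1).coeff 2 = m at *
  have r1' : t * (s * P.q * k) = P.b6 * j * (f - (P.b5 n)⁻¹ * t) := by
    rw [div_eq_mul_inv] at r1
    linear_combination -r1
  have r2' : P.q * t * (m * P.b6 * s') = j * (f - P.b5 n * P.q * t) := by
    refine mul_left_cancel₀ hb6 ?_
    linear_combination -r2
  refine mul_left_cancel₀ (mul_ne_zero hb6 (pow_ne_zero 2 hj0)) ?_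
  linear_combination P.b6 * P.q * t ^ 2 * r3 + (P.q * t * (m * P.b6 * s')) *
    ((f * g - 1) * (f * g' - 1)) * r1' + P.b6 * j * (f - (P.b5 n)⁻¹ * t) *
    ((f * g - 1) * (f * g' - 1)) * r2'

end Gauge

end DeformedBigQJacobi

theorem mainTheorem1 (P : DeformedBigQJacobi.Params) (t : ℂ) (n : ℕ)
    (hq0 : P.q ≠ 0) (hq1 : ‖P.q‖ < 1)
    (hb : P.b1 * P.b2 * P.b3 * P.b4 = 1) (hb6 : P.b6 ≠ 0) (ht : t ≠ 0)
    (hreg : P.Regular t) (hreg' : P.Regular (P.q * t))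
    (hb5_one : P.b5 n ≠ 1) (hb5_neg : P.b5 n ≠ -1)
    (hb5_half : P.q * P.b5 n ^ 2 ≠ 1) (hb5_inv : P.b5 n ≠ P.q⁻¹)
    (a b : Fin 3 × ℕ)
    (p : ℕ → Polynomial ℂ) (hp : P.IsOPS t a b p)
    (p' : ℕ → Polynomial ℂ) (hp' : P.IsOPS (P.q * t) a b p')
    (a₀ : ℂ) (ha₀ : a₀ ≠ 0) (a₀' : ℂ) (ha₀' : a₀' ≠ 0) :
    (∃! S, P.IsSpectral t a b a₀ p n S) ∧
    (∃! S', P.IsSpectral (P.q * t) a b a₀' p' n S') ∧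
    ∀ S S' : DeformedBigQJacobi.SpectralCoeffs,
      P.IsSpectral t a b a₀ p n S → P.IsSpectral (P.q * t) a b a₀' p' n S' →
      (∃! x : ℂ, S.Th.IsRoot x) ∧ (∃! x : ℂ, S'.Th.IsRoot x) ∧
      ∀ g g' f : ℂ, S.Th.IsRoot g → S'.Th.IsRoot g' →
        g ≠ 0 → g ≠ P.b6 * t → g ≠ P.b6⁻¹ * t →
        g' ≠ 0 → g' ≠ P.b6 * (P.q * t) → g' ≠ P.b6⁻¹ * (P.q * t) →
        P.IsFVariable n (P.q * t) S' g' f →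
        f ≠ 0 → P.b5 n * f ≠ t → f ≠ P.b5 n * P.q * t →
        g' ≠ (1 - P.q * P.b5 n * t * g - P.q * P.b5 n ^ 2 + P.q * P.b5 n ^ 2 * f * g) /
          (f - P.b5 n * P.q * t) →
        (f * g' - 1) * (f * g - 1) =
          P.q * t ^ 2 * ((f - P.b1) * (f - P.b2) * (f - P.b3) * (f - P.b4)) /
            ((f - P.b5 n * P.q * t) * (f - (P.b5 n)⁻¹ * t)) := by
  open DeformedBigQJacobi Gauge in
  have hqt := mul_ne_zero hq0 ht
  have := Params.offLatticeAtInfinity_neBot hq0 hq1 hb6 ht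
  have := Params.offLatticeAtInfinity_neBot hq0 hq1 hb6 hqt
  obtain ⟨G, hGa, hG⟩ := Params.exists_representing_gauge hq0 hq1 hb hb6 ht hreg hp ha₀ n
  obtain ⟨G', hGa', hG'⟩ := Params.exists_representing_gauge hq0 hq1 hb hb6 hqt hreg' hp' ha₀' n
  obtain ⟨c, hF⟩ := Params.exists_stieltjes_shift hq0 hq1 hb hb6 ht hreg a b
  refine ⟨existsUnique_isSpectral hq0 hq1 hb6 ht hGa hG,
    existsUnique_isSpectral hq0 hq1 hb6 hqt hGa' hG', fun S S' hS hS' => ?_⟩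
  obtain ⟨-, k01, -, -⟩ := (isSpectral_iff hq0 hq1 hb6 ht hGa hG S).mp hS
  obtain ⟨l00, l01, -, -⟩ := (isSpectral_iff hq0 hq1 hb6 hqt hGa' hG' S').mp hS'
  obtain ⟨hT, hT1⟩ := G.natDegree_Th hq0 hb hb6 hb5_half k01
  obtain ⟨hT', hT1'⟩ := G'.natDegree_Th hq0 hb hb6 hb5_half l01
  refine ⟨existsUnique_isRoot_of_natDegree_le_one hT hT1,
    existsUnique_isRoot_of_natDegree_le_one hT' hT1', ?_⟩
  rintro g g' f hg hg' hg0 hg1 hg2 hg'0 hg'1 hg'2 ⟨κp, κm, zp, zm, Z, hκp, -, hν, hμ, hzp, hZ⟩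
    hf0 hf1 hf2 -
  have h1 : P.b1 ≠ 0 := by rintro h; simp [h] at hb
  have h4 : P.b4 ≠ 0 := by rintro h; simp [h] at hb
  have hb50 : P.b5 n ≠ 0 := by simp [Params.b5, *]
  have hq : P.q - 1 ≠ 0 := by
    refine sub_ne_zero.mpr ?_
    rintro h
    simp [h] at hq1
  -- At the zero of `Θ_n` the diagonal entry of the transfer matrix is `g' κ₊ z₊`.
  have hdiag : (G'.transfer 0 0).eval g' = g' * (κp * zp) := by
    rw [l00, Polynomial.eval_add, hν, Polynomial.eval_mul, hμ, Params.eval_deltaY]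
    field_simp
    ring
  have hf : P.q * t * (G'.transfer 0 0).eval g' =
      -((movingPart P (P.q * t)).eval g' * (f * g' - 1)) := by
    rw [hdiag, hzp, hκp, hZ, eval_movingPart]
    field_simp
    ring
  have hK : (G.transfer 0 1).eval g = 0 := by
    simp [k01, show S.Th.eval g = 0 from hg]
  have hL : (G'.transfer 0 1).eval g' = 0 := by
    simp [l01, show S'.Th.eval g' = 0 from hg']
  have hrel := G.zero_relation G' c hF hq0 hq1 hb hb6 ht hreg hb5_half hK hg0 hg1 hg2
    hL hg'0 hg'1 hg'2 hf0 hf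
  rw [eq_div_iff]
  · linear_combination -hrel
  · refine mul_ne_zero (sub_ne_zero.mpr hf2) (sub_ne_zero.mpr fun h => hf1 ?_)
    rw [h, mul_inv_cancel_left₀ hb50]
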